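/- **Setting.** Let $T>0$, $\mathbb T=\mathbb R/T\mathbb Z$, and let $H(t,u)$, $t\ge u$, be a real-valued function such that $H(t+T,u+T)=H(t,u)$, $H(u,u)=1$, $u\mapsto H(u+x,u)$ is measurable for every $x\ge 0$, and $t\mapsto H(t,u)\in C^1([u,\infty))$ for every $u\in\mathbb R$. Put $K(t,u)=-\frac{\mathrm d}{\mathrm dt}H(t,u)$ and assume that there are constants $0<\lambda_{\min}<\lambda_{\max}<\infty$ with $\lambda_{\min}\le K(t,u)/H(t,u)\le\lambda_{\max}$ for all $t\ge u$. Let $(\tilde X_t,\tilde\Phi_t)_{t\ge 0}$ be the following piecewise-deterministic Markov process on $\mathbb R_+\times\mathbb T$. Between jumps $\tilde\Phi$ is constant and $\tilde X$ decreases at unit rate. When $\tilde X$ reaches $0$, the process jumps immediately: from $(0,\phi)$ it jumps to $(\Delta,\phi+\Delta)$, where $\Delta\ge 0$ has density $u\mapsto K(u+\phi,\phi)$. (Thus $\tilde X_t$ is the time to the next event and $\tilde\Phi_t$ is the phase of that event.) Let $P_t(z,\cdot)$ be the law of $(\tilde X_t,\tilde\Phi_t)$ started from $z$; a measure $\mu$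 is called invariant if $\mu P_t=\mu$ for all $t\ge 0$. **Proposition.** There is exactly one $T$-periodic function $\rho:\mathbb R\to\mathbb R$, integrable over a period, such that for every $t\in\mathbb R$ $$\rho(t)=\int_{-\infty}^t K(t,u)\rho(u)\,\mathrm du,\qquad 1=\int_{-\infty}^t H(t,u)\rho(u)\,\mathrm du .$$ With this $\rho$, set, for $u\ge0$ and $\phi\in\mathbb R$, $$\tilde\mu_\infty(u,\phi)=\frac1T\int_{-\infty}^{\phi-u}K(\phi,v)\rho(v)\,\mathrm dv ,$$ which is $T$-periodic in $\phi$. Then $\tilde\mu_\infty(u,\phi)\,\mathrm du\,\mathrm d\phi$, where $\mathrm d\phi$ is Lebesgue measure of total mass $T$ on $\mathbb T$, is an invariant probability measure of $(\tilde X_t,\tilde\Phi_t)_{t\ge 0}$ on $\mathbb R_+\times\mathbb T$, and it is the only invariant probability measure of this process. -/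

import Mathlib

open MeasureTheory ProbabilityTheory Set Filter Topology
open scoped NNReal ENNReal

noncomputable section

namespace PeriodicRenewal

/-- The density `K(t,u) = -∂H/∂t (t,u)` on `t ≥ u` (one-sided derivative at `t = u`). -/
def density (H : ℝ → ℝ → ℝ) (t u : ℝ) : ℝ := -derivWithin (fun s => H s u) (Ici u) t

/-- `H(t,u) = ℙ(T_{k+1} > t | T_k = u)`, `t ≥ u`, is a `T`-periodic renewal kernel with hazard rate
`K / H` in `[lmin, lmax]`. Values `H t u` with `t < u` are irrelevant. The field `diag` says that
events are strictly increasing in time, and `measurable` that the conditional law of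
`T_{k+1} - T_k` is a measurable function of `T_k`. -/
structure IsRenewalKernel (T lmin lmax : ℝ) (H : ℝ → ℝ → ℝ) : Prop where
  periodic : ∀ t u, u ≤ t → H (t + T) (u + T) = H t u
  diag : ∀ u, H u u = 1
  measurable : ∀ x, 0 ≤ x → Measurable fun u => H (u + x) u
  contDiffOn : ∀ u, ContDiffOn ℝ 1 (fun t => H t u) (Ici u)
  lmin_pos : 0 < lmin
  lmin_lt_lmax : lmin < lmax
  le_rate : ∀ t u, u ≤ t → lmin ≤ density H t u / H t u
  rate_le : ∀ t u, u ≤ t → density H t u / H t u ≤ lmax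

/-- `ρ ∈ L¹(ℝ/Tℤ)`, seen as a `T`-periodic function, solves the two integral equations
`ρ(t) = ∫_{-∞}^t K(t,u) ρ(u) du` and `1 = ∫_{-∞}^t H(t,u) ρ(u) du` for every `t`. -/
structure IsStationaryIntensity (T : ℝ) (H : ℝ → ℝ → ℝ) (ρ : ℝ → ℝ) : Prop where
  periodic : Function.Periodic ρ T
  integrable : IntegrableOn ρ (Ioc 0 T)
  eq_integral : ∀ t, ρ t = ∫ u in Iic t, density H t u * ρ u
  normalized : ∀ t, 1 = ∫ u in Iic t, H t u * ρ u

/-- Lebesgue measure on `ℝ₊`. -/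
def volumeNN : Measure ℝ≥0 := (volume.restrict (Ici (0 : ℝ))).map Real.toNNReal

/-- The state space `ℝ₊ × ℝ/Tℤ`. -/
abbrev State (T : ℝ) : Type := ℝ≥0 × AddCircle T

/-- The representative in `[0, T)` of a phase. -/
def phaseRep {T : ℝ} [hT : Fact (0 < T)] (φ : AddCircle T) : ℝ := (AddCircle.equivIco T 0 φ : ℝ)

/-- `μ̃_∞(u,φ) = (1/T) ∫_{-∞}^{φ-u} K(φ,v) ρ(v) dv`; it is `T`-periodic in `φ`. -/
def muDensity (T : ℝ) (H : ℝ → ℝ → ℝ) (ρ : ℝ → ℝ) (u φ : ℝ) : ℝ :=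
  (1 / T) * ∫ v in Iic (φ - u), density H φ v * ρ v

/-- The measure `μ̃_∞(u,φ) du dφ` on `ℝ₊ × ℝ/Tℤ`; here `dφ` has total mass `T`. -/
def muInfty (T : ℝ) [Fact (0 < T)] (H : ℝ → ℝ → ℝ) (ρ : ℝ → ℝ) : Measure (State T) :=
  (volumeNN.prod (volume : Measure (AddCircle T))).withDensity
    fun p => ENNReal.ofReal (muDensity T H ρ p.1 (phaseRep p.2))

/-- Given the phase `φ` of an event, the law `K(x+φ,φ) dx` of the waiting time for the next one. -/
def waitingKernel (T : ℝ) [Fact (0 < T)] (H : ℝ → ℝ → ℝ) : Kernel (AddCircle T) ℝ≥0 :=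
  haveI : SFinite volumeNN := by unfold volumeNN; infer_instance
  (Kernel.const (AddCircle T) volumeNN).withDensity
    fun φ x => ENNReal.ofReal (density H (x + phaseRep φ) (phaseRep φ))

/-- The jump law from `(0, φ)`: the new state is `(Δ, φ + Δ)` with `Δ` of law `K(x+φ,φ) dx`. -/
def jumpKernel (T : ℝ) [Fact (0 < T)] (H : ℝ → ℝ → ℝ) : Kernel (AddCircle T) (State T) :=
  (Kernel.id ×ₖ waitingKernel T H).map fun p => (p.2, p.1 + (((p.2 : ℝ≥0) : ℝ) : AddCircle T))

section Measurability

variable {T lmin lmax : ℝ} {H : ℝ → ℝ → ℝ}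

lemma measurable_phaseRep [Fact (0 < T)] : Measurable (phaseRep : AddCircle T → ℝ) :=
  measurable_subtype_coe.comp (AddCircle.measurableEquivIco T 0).measurable

lemma measurable_jump :
    Measurable fun p : AddCircle T × ℝ≥0 => (p.2, p.1 + (((p.2 : ℝ≥0) : ℝ) : AddCircle T)) := by
  refine measurable_snd.prodMk (measurable_fst.add ?_)
  exact AddCircle.measurable_mk'.comp (measurable_coe_nnreal_real.comp measurable_snd)

lemma IsRenewalKernel.hasDerivWithinAt (hH : IsRenewalKernel T lmin lmax H) {t u : ℝ}
    (h : u ≤ t) : HasDerivWithinAt (fun s => H s u) (-density H t u) (Ici u) t := by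
  have := ((hH.contDiffOn u).differentiableOn one_ne_zero t h).hasDerivWithinAt
  simpa [density] using this

lemma IsRenewalKernel.pos (hH : IsRenewalKernel T lmin lmax H) {t u : ℝ} (h : u ≤ t) :
    0 < H t u := by
  have hne : ∀ s, u ≤ s → H s u ≠ 0 := fun s hs h0 => by
    have := hH.le_rate s u hs
    rw [h0, div_zero] at this
    exact absurd hH.lmin_pos (not_lt.mpr this)
  by_contra hneg
  have hc : ContinuousOn (fun s => H s u) (Icc u t) :=
    (hH.contDiffOn u).continuousOn.mono Icc_subset_Ici_self
  have := intermediate_value_Icc' h hc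
  obtain ⟨s, hs, hs0⟩ := this (show (0 : ℝ) ∈ Icc (H t u) (H u u) from
    ⟨not_lt.mp hneg, by rw [hH.diag]; exact zero_le_one⟩)
  exact hne s hs.1 hs0

lemma IsRenewalKernel.le_density (hH : IsRenewalKernel T lmin lmax H) {t u : ℝ} (h : u ≤ t) :
    lmin * H t u ≤ density H t u :=
  (le_div_iff₀ (hH.pos h)).mp (hH.le_rate t u h)

lemma IsRenewalKernel.density_nonneg (hH : IsRenewalKernel T lmin lmax H) {t u : ℝ}
    (h : u ≤ t) : 0 ≤ density H t u :=
  (mul_nonneg hH.lmin_pos.le (hH.pos h).le).trans (hH.le_density h)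

lemma IsRenewalKernel.le_exp (hH : IsRenewalKernel T lmin lmax H) {x u : ℝ} (hx : 0 ≤ x) :
    H (u + x) u ≤ Real.exp (-(lmin * x)) := by
  have key : AntitoneOn (fun s => H s u * Real.exp (lmin * (s - u))) (Ici u) := by
    have hd : ∀ s ∈ Ici u, HasDerivWithinAt (fun s => H s u * Real.exp (lmin * (s - u)))
        (-density H s u * Real.exp (lmin * (s - u))
          + H s u * (Real.exp (lmin * (s - u)) * lmin)) (Ici u) s := fun s hs => by
      have h1 := hH.hasDerivWithinAt (t := s) (u := u) hs
      have h2 : HasDerivAt (fun s => Real.exp (lmin * (s - u)))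
          (Real.exp (lmin * (s - u)) * lmin) s := by
        have : HasDerivAt (fun s => lmin * (s - u)) lmin s := by
          simpa using ((hasDerivAt_id s).sub_const u).const_mul lmin
        exact this.exp
      exact h1.mul h2.hasDerivWithinAt
    refine antitoneOn_of_hasDerivWithinAt_nonpos (convex_Ici u)
      (fun s hs => (hd s hs).continuousWithinAt)
      (fun s hs => (hd s (interior_subset hs)).mono interior_subset) fun s hs => ?_
    have h1 := hH.le_density (t := s) (u := u) (interior_subset hs)
    nlinarith [Real.exp_pos (lmin * (s - u))]
  have h := key (self_mem_Ici (a := u)) (show u + x ∈ Ici u from by simpa using hx)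
    (by simpa using hx)
  simp only [sub_self, mul_zero, Real.exp_zero, hH.diag, mul_one, add_sub_cancel_left] at h
  rw [Real.exp_neg, ← one_div, le_div_iff₀ (Real.exp_pos _)]
  exact h

lemma IsRenewalKernel.measurable_density (hH : IsRenewalKernel T lmin lmax H) :
    Measurable fun p : ℝ≥0 × ℝ => density H (p.1 + p.2) p.2 := by
  have hm : Measurable fun p : ℝ≥0 × ℝ => H (p.1 + p.2) p.2 := by
    refine (measurable_uncurry_of_continuous_of_measurable
      (u := fun (x : ℝ≥0) (r : ℝ) => H (x + r) r) (fun r => ?_) (fun x => ?_) :)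
    · refine (hH.contDiffOn r).continuousOn.comp_continuous (by fun_prop) fun x => ?_
      simp
    · simpa [add_comm] using hH.measurable x x.2
  let e : ℕ → ℝ≥0 := fun n => 1 / ((n : ℝ≥0) + 1)
  have hlim : ∀ p : ℝ≥0 × ℝ, Tendsto
      (fun n : ℕ => -(((e n : ℝ≥0) : ℝ)⁻¹ * (H (((p.1 + e n : ℝ≥0) : ℝ) + p.2) p.2
        - H (p.1 + p.2) p.2))) atTop (𝓝 (density H (p.1 + p.2) p.2)) := fun p => by
    have h0 : p.2 ≤ (p.1 : ℝ) + p.2 := by simp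
    have h1 : HasDerivWithinAt (fun s => H s p.2) (-density H (p.1 + p.2) p.2)
        (Ioi (p.1 + p.2)) (p.1 + p.2) :=
      (hH.hasDerivWithinAt h0).mono ((Ioi_subset_Ici_self).trans (Ici_subset_Ici.mpr h0))
    rw [hasDerivWithinAt_iff_tendsto_slope' (by simp)] at h1
    have h2 : Tendsto (fun n : ℕ => ((p.1 + e n : ℝ≥0) : ℝ) + p.2) atTop
        (𝓝[>] ((p.1 : ℝ) + p.2)) := by
      refine tendsto_nhdsWithin_iff.mpr ⟨?_, Eventually.of_forall fun n => ?_⟩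
      · have : Tendsto (fun n : ℕ => (1 : ℝ) / ((n : ℝ) + 1)) atTop (𝓝 0) :=
          tendsto_one_div_add_atTop_nhds_zero_nat
        have h3 := (this.const_add (p.1 : ℝ)).add_const p.2
        simpa [e] using h3
      · have : (0 : ℝ) < (n : ℝ) + 1 := by positivity
        simp only [mem_Ioi, NNReal.coe_add, e]
        push_cast
        have : (0 : ℝ) < 1 / ((n : ℝ) + 1) := by positivity
        linarith
    have h3 := (h1.comp h2).neg
    rw [neg_neg] at h3
    refine h3.congr fun n => ?_
    simp only [Function.comp, slope, vsub_eq_sub, smul_eq_mul, NNReal.coe_add]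
    congr 3
    ring
  refine measurable_of_tendsto_metrizable (fun n => ?_) (tendsto_pi_nhds.mpr hlim)
  refine ((Measurable.sub ?_ hm).const_mul _).neg
  exact hm.comp ((measurable_fst.add_const (e n)).prodMk measurable_snd)

lemma IsRenewalKernel.measurable_waitingDensity [Fact (0 < T)]
    (hH : IsRenewalKernel T lmin lmax H) :
    Measurable (Function.uncurry fun (φ : AddCircle T) (x : ℝ≥0) =>
      ENNReal.ofReal (density H (x + phaseRep φ) (phaseRep φ))) :=
  (hH.measurable_density.comp
    (measurable_snd.prodMk (measurable_phaseRep.comp measurable_fst))).ennreal_ofReal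

lemma IsRenewalKernel.isMarkovKernel_waitingKernel [Fact (0 < T)]
    (hH : IsRenewalKernel T lmin lmax H) : IsMarkovKernel (waitingKernel T H) := by
  refine ⟨fun φ => ⟨?_⟩⟩
  have : SFinite volumeNN := by unfold volumeNN; infer_instance
  set r := phaseRep φ with hr
  have hm : Measurable fun x : ℝ≥0 => ENNReal.ofReal (density H (x + r) r) :=
    hH.measurable_waitingDensity.of_uncurry_left (x := φ)
  rw [waitingKernel, Kernel.withDensity_apply' _ hH.measurable_waitingDensity,
    Measure.restrict_univ, Kernel.const_apply, volumeNN, lintegral_map hm measurable_real_toNNReal,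
    setLIntegral_congr Ioi_ae_eq_Ici.symm]
  have hnn : ∀ x ∈ Ioi (0 : ℝ), 0 ≤ density H (x + r) r := fun x hx =>
    hH.density_nonneg (by have := mem_Ioi.mp hx; linarith)
  have hd : ∀ x ∈ Ioi (0 : ℝ), HasDerivAt (fun x => -H (x + r) r) (density H (x + r) r) x :=
    fun x hx => by
      have hx' : r < x + r := by have := mem_Ioi.mp hx; linarith
      have h1 := (hH.hasDerivWithinAt hx'.le).hasDerivAt (Ici_mem_nhds hx')
      have h2 := (h1.comp_add_const x r).fun_neg
      rwa [neg_neg] at h2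
  have hc : ContinuousWithinAt (fun x => -H (x + r) r) (Ici 0) 0 := by
    have h1 : ContinuousOn (fun x => -H (x + r) r) (Ici 0) :=
      ((hH.contDiffOn r).continuousOn.comp (f := fun x : ℝ => x + r) (by fun_prop)
        (fun x hx => by simpa using hx)).neg
    exact h1 0 self_mem_Ici
  have hl : Tendsto (fun x => -H (x + r) r) atTop (𝓝 (-0)) := by
    refine Tendsto.neg (squeeze_zero' (g := fun x => Real.exp (-(lmin * x)))
      (eventually_ge_atTop 0 |>.mono fun x hx => (hH.pos (by linarith)).le)
      (eventually_ge_atTop 0 |>.mono fun x hx => ?_) ?_)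
    · rw [add_comm]; exact hH.le_exp hx
    · exact Real.tendsto_exp_neg_atTop_nhds_zero.comp
        (tendsto_id.const_mul_atTop hH.lmin_pos)
  have hint := integral_Ioi_of_hasDerivAt_of_nonneg hc hd hnn hl
  have hI := integrableOn_Ioi_deriv_of_nonneg hc hd hnn hl
  have hcongr : ∫⁻ x in Ioi (0 : ℝ), ENNReal.ofReal (density H ((x.toNNReal : ℝ) + r) r)
      = ∫⁻ x in Ioi (0 : ℝ), ENNReal.ofReal (density H (x + r) r) :=
    setLIntegral_congr_fun measurableSet_Ioi fun x hx => by
      simp only [Real.coe_toNNReal x (mem_Ioi.mp hx).le]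
  rw [hcongr, ← ofReal_integral_eq_lintegral_ofReal hI
    ((ae_restrict_iff' measurableSet_Ioi).mpr (Eventually.of_forall hnn)), hint]
  simp [hH.diag]

lemma IsRenewalKernel.isMarkovKernel_jumpKernel [Fact (0 < T)]
    (hH : IsRenewalKernel T lmin lmax H) : IsMarkovKernel (jumpKernel T H) := by
  have := hH.isMarkovKernel_waitingKernel
  exact Kernel.IsMarkovKernel.map _ measurable_jump

end Measurability

/-- For a starting state `z`, the law of the Markov chain `(Z_n)_{n ≥ 0}` with `Z_0 = z` and
`Z_{n+1}` drawn from the jump law at the phase of `Z_n`: for `n ≥ 1`, `Z_n` is the state of the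
process just after its `n`-th jump. -/
def chainKernel {T lmin lmax : ℝ} [Fact (0 < T)] {H : ℝ → ℝ → ℝ}
    (hH : IsRenewalKernel T lmin lmax H) : Kernel (State T) (ℕ → State T) :=
  haveI := hH.isMarkovKernel_jumpKernel
  (Kernel.traj (X := fun _ => State T)
    (fun n => (jumpKernel T H).comap
      (fun h : (i : Finset.Iic n) → State T => (h ⟨n, Finset.mem_Iic.mpr le_rfl⟩).2)
      (measurable_snd.comp (measurable_pi_apply _))) 0).comap
    (fun z _ => z) (measurable_pi_lambda _ fun _ => measurable_id)

/-- The time `x_0 + ⋯ + x_n` of the jump number `n + 1`, where `x_k` is the first coordinate of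
`Z_k`: that coordinate decays at unit rate and the process jumps when it reaches zero. -/
def jumpTime {T : ℝ} (z : ℕ → State T) (n : ℕ) : ℝ≥0 := ∑ k ∈ Finset.range (n + 1), (z k).1

/-- The number of jumps in `[0, t]` (`0` if there are infinitely many, a null event). -/
def jumpCount {T : ℝ} (t : ℝ≥0) (z : ℕ → State T) : ℕ := sInf {n | t < jumpTime z n}

/-- The state `(X̃_t, Φ̃_t)` at time `t`, from the sequence of post-jump states: the first coordinate
is the time left until the next jump, and the second is constant between jumps. -/
def pdmpState {T : ℝ} (t : ℝ≥0) (z : ℕ → State T) : State T :=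
  (jumpTime z (jumpCount t z) - t, (z (jumpCount t z)).2)

lemma measurable_jumpTime {T : ℝ} (n : ℕ) :
    Measurable fun z : ℕ → State T => jumpTime z n :=
  Finset.measurable_sum _ fun k _ => measurable_fst.comp (measurable_pi_apply k)

lemma measurable_jumpCount {T : ℝ} (t : ℝ≥0) :
    Measurable (jumpCount t : (ℕ → State T) → ℕ) := by
  have hm : ∀ n, MeasurableSet {z : ℕ → State T | t < jumpTime z n} := fun n =>
    measurableSet_lt measurable_const (measurable_jumpTime n)
  have hle : ∀ n, MeasurableSet {z : ℕ → State T | n < jumpCount t z} := fun n => by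
    have : {z : ℕ → State T | n < jumpCount t z}
        = (⋂ k ∈ Finset.range (n + 1), {z : ℕ → State T | t < jumpTime z k}ᶜ)
          ∩ ⋃ k, {z : ℕ → State T | t < jumpTime z k} := by
      ext z
      simp only [mem_ofPred_eq, mem_inter_iff, mem_iInter, mem_iUnion, mem_compl_iff,
        Finset.mem_range]
      constructor
      · intro h
        refine ⟨fun k hk hk' => ?_, ?_⟩
        · have : jumpCount t z ≤ k := Nat.sInf_le hk'
          omega
        · by_contra hne
          have he : {n | t < jumpTime z n} = ∅ := by
            ext k
            simpa using not_exists.mp hne k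
          rw [jumpCount, he, Nat.sInf_empty] at h
          omega
      · rintro ⟨h1, h2⟩
        by_contra hlt
        exact h1 (jumpCount t z) (by omega) (Nat.sInf_mem (s := {n | t < jumpTime z n}) h2)
    rw [this]
    exact (Finset.measurableSet_biInter _ fun k _ => (hm k).compl).inter
      (MeasurableSet.iUnion hm)
  exact measurable_of_Ioi fun n => hle n

lemma measurable_pdmpState {T : ℝ} (t : ℝ≥0) :
    Measurable (pdmpState t : (ℕ → State T) → State T) := by
  have h1 : Measurable fun p : ℕ × (ℕ → State T) => jumpTime p.2 p.1 - t :=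
    measurable_from_prod_countable_right fun n => (measurable_jumpTime n).sub_const t
  have h2 : Measurable fun p : ℕ × (ℕ → State T) => (p.2 p.1).2 :=
    measurable_from_prod_countable_right fun n =>
      measurable_snd.comp (measurable_pi_apply n)
  have h3 : Measurable fun z : ℕ → State T => (jumpCount t z, z) :=
    (measurable_jumpCount t).prodMk measurable_id
  unfold pdmpState
  exact (h1.comp h3).prodMk (h2.comp h3)

/-- The transition semigroup `P_t(z, ·)`: the law of `(X̃_t, Φ̃_t)` when the process starts
at `z`. -/
def semigroup {T lmin lmax : ℝ} [Fact (0 < T)] {H : ℝ → ℝ → ℝ}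
    (hH : IsRenewalKernel T lmin lmax H) (t : ℝ≥0) : Kernel (State T) (State T) :=
  (chainKernel hH).map (pdmpState t)

instance {T lmin lmax : ℝ} [Fact (0 < T)] {H : ℝ → ℝ → ℝ}
    (hH : IsRenewalKernel T lmin lmax H) (t : ℝ≥0) : IsMarkovKernel (semigroup hH t) := by
  have := hH.isMarkovKernel_jumpKernel
  have : IsMarkovKernel (chainKernel hH) := by unfold chainKernel; infer_instance
  exact Kernel.IsMarkovKernel.map _ (measurable_pdmpState t)

/-- `μ` is invariant for the process: `μ P_t = μ` for every `t ≥ 0`. -/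
def IsInvariant {T lmin lmax : ℝ} [Fact (0 < T)] {H : ℝ → ℝ → ℝ}
    (hH : IsRenewalKernel T lmin lmax H) (μ : Measure (State T)) : Prop :=
  ∀ t : ℝ≥0, (semigroup hH t).Invariant μ

end PeriodicRenewal

end

/-! Let `𝒦f(t) = ∫_{u ≤ t} K(t,u) f(u) du` act on periodic functions (`convolve (waitDensity T H)`
on the circle). It carries the phase density of one event to that of the next. It preserves mass,
its kernel is strictly positive, and it satisfies a Doeblin bound: `K(u+x,u) ≥ c = lmin * exp(-lmax
* T)` for `x ∈ [0,T]`, and `x ∈ [0,T)` sweeps the circle exactly once.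

Existence of `ρ`. Subtracting the floor gives `𝒦f = Rf + c∫f` with `R ≥ 0`. The series `f = ∑ Rⁿ1`
has mass `1/c`, so `𝒦f = (f - 1) + 1 = f` at every point (`exists_invariant_density`). Formally,
`d/dt ∫ H(t,u) f(u) du = f(t) - 𝒦f(t) = 0`, so this integral is a constant
(`convolve_waitSurvival_const`). It is positive and finite, and division by it gives `ρ`.

Uniqueness of `ρ`. If `d = 𝒦d`, then `d⁺ ≤ 𝒦d⁺`. Both sides have the same mass, so they agree a.e.,
and positivity of the kernel gives `d` a constant sign (`nonpos_or_nonneg`). The difference of two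
solutions has constant sign and satisfies `∫ H(t,u) d(u) du = 0`. Since `K ≤ lmax * H`, it vanishes.

Invariance. By Palm's formula (`lintegral_muInfty`), `μ̃_∞` is `1/T` times the mean occupation
measure of one waiting time, when the phase of the event opening it has density `ρ`. Running the
process for a time `t` moves the window `[0,x₀]` of the path to `[t,t+x₀]`, that is, it trades the
piece `[0,t]` for `[x₀,x₀+t]`. The two pieces have the same mean, because `ρ` is invariant under the
jumps (`lintegral_pathOccupation`). This rests on first step analysis (`markovChain_eq_cons`) and
non-explosion (`ae_exists_lt_jumpTime`). The semigroup law `P_s P_t = P_{s+t}` is never needed.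

Uniqueness of the invariant law. Positivity of `K` makes every null set of a nonzero invariant
measure Lebesgue-null on `[0,T] × ℝ/Tℤ`, so two such measures are never mutually singular. For
invariant probabilities `μ`, `ν`, the Jordan parts `μ - ν` and `ν - μ` are invariant
(`IsInvariant.sub`) and mutually singular. Hence one of them is zero, and equality of masses gives
`μ = ν`. -/

noncomputable section

namespace PeriodicRenewal

/-! ### Markov chains on path space: characterization of the law and first step analysis. -/

section Chain

/-- Prepend a state to a sequence of states. -/
def cons {S : Type*} (z : S) (ω : ℕ → S) : ℕ → S := fun n => Nat.casesOn n z ω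

/-- Prepend a state to a finite sequence of states. -/
def consIic {S : Type*} (n : ℕ) (z : S) (p : (i : Finset.Iic n) → S) :
    (i : Finset.Iic (n + 1)) → S :=
  fun i => if h : (i : ℕ) = 0 then z else
    p ⟨(i : ℕ) - 1, Finset.mem_Iic.mpr (by have := Finset.mem_Iic.mp i.2; omega)⟩

variable {S : Type*}

@[simp] lemma cons_zero (z : S) (ω : ℕ → S) : cons z ω 0 = z := rfl

@[simp] lemma cons_succ (z : S) (ω : ℕ → S) (n : ℕ) : cons z ω (n + 1) = ω n := rfl

lemma cons_shift (ω : ℕ → S) : cons (ω 0) (fun n => ω (n + 1)) = ω := by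
  funext n
  cases n <;> rfl

lemma cons_update (z : S) (ω : ℕ → S) (n : ℕ) (y : S) :
    cons z (Function.update ω n y) = Function.update (cons z ω) (n + 1) y := by
  funext k
  cases k with
  | zero => simp
  | succ k => by_cases h : k = n <;> simp [h]

lemma frestrictLe_cons (n : ℕ) (z : S) (ω : ℕ → S) :
    Preorder.frestrictLe (π := fun _ => S) (n + 1) (cons z ω)
      = consIic n z (Preorder.frestrictLe (π := fun _ => S) n ω) := by
  funext i
  obtain ⟨i, hi⟩ := i
  cases i with
  | zero => simp [consIic]
  | succ i => simp [consIic]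

variable [MeasurableSpace S]

lemma measurable_cons : Measurable fun p : S × (ℕ → S) => cons p.1 p.2 := by
  refine measurable_pi_lambda _ fun n => ?_
  cases n with
  | zero => exact measurable_fst
  | succ n => exact (measurable_pi_apply n).comp measurable_snd

lemma measurable_cons_left (z : S) : Measurable (cons z : (ℕ → S) → ℕ → S) :=
  measurable_cons.comp measurable_prodMk_left

lemma measurable_consIic (n : ℕ) (z : S) : Measurable (consIic (S := S) n z) := by
  refine measurable_pi_lambda _ fun i => ?_
  by_cases h : (i : ℕ) = 0
  · simp [consIic, h]
  · simpa [consIic, h] using measurable_pi_apply _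

/-- The transition kernel of the homogeneous Markov chain, as a function of the whole past. -/
def pastKernel (J : Kernel S S) (n : ℕ) : Kernel ((i : Finset.Iic n) → S) S :=
  J.comap (fun h => h ⟨n, Finset.mem_Iic.mpr le_rfl⟩) (measurable_pi_apply _)

instance (J : Kernel S S) [IsMarkovKernel J] (n : ℕ) : IsMarkovKernel (pastKernel J n) := by
  unfold pastKernel; infer_instance

/-- Translates resampling of coordinate `b + 1` into the gluing map from which `Kernel.partialTraj`
is built. -/
lemma frestrictLe_update (b : ℕ) (ω : ℕ → S) (y : S) :
    Preorder.frestrictLe (π := fun _ => S) (b + 1) (Function.update ω (b + 1) y)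
      = IicProdIoc (X := fun _ => S) b (b + 1) (Preorder.frestrictLe (π := fun _ => S) b ω,
          MeasurableEquiv.piSingleton (X := fun _ => S) b y) := by
  funext i
  obtain ⟨i, hi⟩ := i
  rw [Finset.mem_Iic] at hi
  by_cases h : i ≤ b
  · have : i ≠ b + 1 := by omega
    simp [IicProdIoc_def, h, this]
  · obtain rfl : i = b + 1 := by omega
    simp [IicProdIoc_def, MeasurableEquiv.piSingleton]

lemma lintegral_partialTraj_succ (J : Kernel S S) [IsMarkovKernel J] (b : ℕ)
    (h : (i : Finset.Iic 0) → S) {F : ((i : Finset.Iic (b + 1)) → S) → ℝ≥0∞} (hF : Measurable F) :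
    ∫⁻ p, F p ∂(Kernel.partialTraj (X := fun _ => S) (pastKernel J) 0 (b + 1) h)
      = ∫⁻ p, ∫⁻ y, F (IicProdIoc (X := fun _ => S) b (b + 1)
          (p, MeasurableEquiv.piSingleton (X := fun _ => S) b y)) ∂(pastKernel J b p)
        ∂(Kernel.partialTraj (X := fun _ => S) (pastKernel J) 0 b h) := by
  have hm : Measurable (IicProdIoc (X := fun _ => S) b (b + 1)) := measurable_IicProdIoc
  have hFm : Measurable fun p => F (IicProdIoc (X := fun _ => S) b (b + 1) p) := hF.comp hm
  have hp : Measurable (MeasurableEquiv.piSingleton (X := fun _ => S) b) :=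
    MeasurableEquiv.measurable _
  rw [Kernel.partialTraj_succ_of_le (Nat.zero_le b), Kernel.lintegral_map _ hm _ hF,
    Kernel.lintegral_comp _ _ _ hFm]
  refine lintegral_congr fun p => ?_
  rw [Kernel.lintegral_id_prod hFm]
  exact Kernel.lintegral_map _ hp p (hFm.comp (measurable_prodMk_left (x := p)))


/-- `ν` is the law of a Markov chain with transition kernel `J` started at `z`. -/
structure IsChainLaw (J : Kernel S S) (z : S) (ν : Measure (ℕ → S)) : Prop where
  prob : IsProbabilityMeasure ν
  init : ν.map (fun ω => ω 0) = Measure.dirac z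
  -- The Markov property as resampling: redrawing coordinate `b + 1` from `J (ω b)` leaves the law
  -- of the coordinates up to `b + 1` unchanged. In this form it is compatible with prepending a
  -- state, through `cons_update`.
  step : ∀ (b : ℕ) (F : ((i : Finset.Iic (b + 1)) → S) → ℝ≥0∞), Measurable F →
    ∫⁻ ω, F (Preorder.frestrictLe (π := fun _ => S) (b + 1) ω) ∂ν
      = ∫⁻ ω, ∫⁻ y, F (Preorder.frestrictLe (π := fun _ => S) (b + 1)
          (Function.update ω (b + 1) y)) ∂(J (ω b)) ∂ν

lemma measurable_step {J : Kernel S S} [IsSFiniteKernel J] (b : ℕ)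
    {F : (ℕ → S) → ℝ≥0∞} (hF : Measurable F) :
    Measurable fun ω : ℕ → S => ∫⁻ y, F (Function.update ω (b + 1) y) ∂(J (ω b)) := by
  have hu : Measurable fun p : (ℕ → S) × S => Function.update p.1 (b + 1) p.2 := by
    refine measurable_pi_lambda _ fun n => ?_
    by_cases h : n = b + 1
    · subst h; simpa using measurable_snd
    · simpa [h, Function.comp_def] using (measurable_pi_apply n).comp measurable_fst
  exact (hF.comp hu).lintegral_kernel_prod_right' (κ := J.comap (fun ω : ℕ → S => ω b)
    (measurable_pi_apply b))

/-- The law of the Markov chain with transition kernel `J`, as a kernel in the starting point. -/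
def markovChain (J : Kernel S S) [IsMarkovKernel J] : Kernel S (ℕ → S) :=
  (Kernel.traj (X := fun _ => S) (pastKernel J) 0).comap (fun z _ => z)
    (measurable_pi_lambda _ fun _ => measurable_id)

instance (J : Kernel S S) [IsMarkovKernel J] : IsMarkovKernel (markovChain J) := by
  unfold markovChain; infer_instance

lemma markovChain_map_frestrictLe (J : Kernel S S) [IsMarkovKernel J] (z : S) (b : ℕ) :
    (markovChain J z).map (Preorder.frestrictLe (π := fun _ => S) b)
      = Kernel.partialTraj (X := fun _ => S) (pastKernel J) 0 b fun _ => z := by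
  rw [markovChain, Kernel.comap_apply, Kernel.traj_map_frestrictLe_apply]

lemma isChainLaw_markovChain (J : Kernel S S) [IsMarkovKernel J] (z : S) :
    IsChainLaw J z (markovChain J z) where
  prob := inferInstance
  init := by
    have h := markovChain_map_frestrictLe J z 0
    rw [Kernel.partialTraj_self, Kernel.id_apply] at h
    have h2 := congrArg (Measure.map fun p : (i : Finset.Iic 0) → S => p ⟨0, by simp⟩) h
    rw [Measure.map_map (by fun_prop) (Preorder.measurable_frestrictLe (X := fun _ => S) 0),
      Measure.map_dirac' (by fun_prop)] at h2
    exact h2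
  step b F hF := by
    have hm := fun b : ℕ => Preorder.measurable_frestrictLe (X := fun _ => S) b
    rw [← lintegral_map hF (hm _), markovChain_map_frestrictLe,
      lintegral_partialTraj_succ J b _ hF, ← markovChain_map_frestrictLe, lintegral_map ?_ (hm b)]
    · simp_rw [frestrictLe_update]
      rfl
    · have hm : Measurable (IicProdIoc (X := fun _ => S) b (b + 1)) := measurable_IicProdIoc
      have hp : Measurable (MeasurableEquiv.piSingleton (X := fun _ => S) b) :=
        MeasurableEquiv.measurable _
      have : Measurable fun q : ((i : Finset.Iic b) → S) × S =>
          F (IicProdIoc (X := fun _ => S) b (b + 1)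
          (q.1, MeasurableEquiv.piSingleton (X := fun _ => S) b q.2)) :=
        hF.comp (hm.comp (measurable_fst.prodMk (hp.comp measurable_snd)))
      exact this.lintegral_kernel_prod_right'

/-- `init` and `step` determine the finite-dimensional laws by induction, and a projective limit of
finite measures is unique. -/
lemma IsChainLaw.eq_markovChain {J : Kernel S S} [IsMarkovKernel J] {z : S}
    {ν : Measure (ℕ → S)} (hν : IsChainLaw J z ν) : ν = markovChain J z := by
  have hm := fun b : ℕ => Preorder.measurable_frestrictLe (X := fun _ => S) b
  have := hν.prob
  have key : ∀ b, ν.map (Preorder.frestrictLe (π := fun _ => S) b)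
      = (markovChain J z).map (Preorder.frestrictLe (π := fun _ => S) b) := by
    intro b
    induction b with
    | zero =>
      have e : Preorder.frestrictLe (π := fun _ => S) 0
          = (fun (y : S) (_ : Finset.Iic 0) => y) ∘ fun ω : ℕ → S => ω 0 := by
        funext ω i
        obtain ⟨i, hi⟩ := i
        obtain rfl : i = 0 := by simpa using hi
        rfl
      have hc : Measurable fun (y : S) (_ : Finset.Iic 0) => y :=
        measurable_pi_lambda _ fun _ => measurable_id
      rw [e, ← Measure.map_map hc (measurable_pi_apply 0),
        ← Measure.map_map hc (measurable_pi_apply 0), hν.init, (isChainLaw_markovChain J z).init]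
    | succ b ih =>
      refine Measure.ext_of_lintegral _ fun F hF => ?_
      rw [lintegral_map hF (hm _), lintegral_map hF (hm _), hν.step b F hF,
        (isChainLaw_markovChain J z).step b F hF]
      simp_rw [frestrictLe_update]
      have hm' : Measurable (IicProdIoc (X := fun _ => S) b (b + 1)) := measurable_IicProdIoc
      have hp : Measurable (MeasurableEquiv.piSingleton (X := fun _ => S) b) :=
        MeasurableEquiv.measurable _
      have h1 : Measurable fun q : ((i : Finset.Iic b) → S) × S =>
          F (IicProdIoc (X := fun _ => S) b (b + 1)
          (q.1, MeasurableEquiv.piSingleton (X := fun _ => S) b q.2)) :=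
        hF.comp (hm'.comp (measurable_fst.prodMk (hp.comp measurable_snd)))
      have h2 := h1.lintegral_kernel_prod_right' (κ := pastKernel J b)
      have h3 : ∀ ν' : Measure (ℕ → S), ∫⁻ ω, ∫⁻ y, F (IicProdIoc (X := fun _ => S) b (b + 1)
          (Preorder.frestrictLe (π := fun _ => S) b ω,
            MeasurableEquiv.piSingleton (X := fun _ => S) b y)) ∂(J (ω b)) ∂ν'
          = ∫⁻ p, ∫⁻ y, F (IicProdIoc (X := fun _ => S) b (b + 1)
          (p, MeasurableEquiv.piSingleton (X := fun _ => S) b y)) ∂(pastKernel J b p)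
            ∂(ν'.map (Preorder.frestrictLe (π := fun _ => S) b)) := fun ν' => by
        rw [lintegral_map h2 (hm b)]
        rfl
      rw [h3, h3, ih]
  rw [markovChain, Kernel.comap_apply, Kernel.traj_apply]
  have : ∀ b, IsProbabilityMeasure
      (Kernel.partialTraj (X := fun _ => S) (pastKernel J) 0 b fun _ => z) := fun b => by
    infer_instance
  have hfin : ∀ I : Finset ℕ, IsFiniteMeasure (inducedFamily (X := fun _ => S) (fun b =>
      Kernel.partialTraj (X := fun _ => S) (pastKernel J) 0 b fun _ => z) I) := fun I =>
    Measure.isFiniteMeasure_map _ _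
  refine (Kernel.isProjectiveLimit_trajFun (X := fun _ => S) (pastKernel J) 0
    (fun _ => z)).unique ?_ |>.symm
  refine (isProjectiveLimit_nat_iff
    (Kernel.isProjectiveMeasureFamily_partialTraj (X := fun _ => S) (pastKernel J) _) _).2
    fun b => ?_
  rw [inducedFamily_Iic]
  exact (key b).trans (markovChain_map_frestrictLe J z b)

/-- First step analysis: after its starting point, the chain is the chain started from a
transition. -/
lemma markovChain_eq_cons (J : Kernel S S) [IsMarkovKernel J] (z : S) :
    markovChain J z = ((J z).bind (markovChain J)).map (cons z) := by
  have hc := measurable_cons_left z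
  have hm := fun b : ℕ => Preorder.measurable_frestrictLe (X := fun _ => S) b
  have hk : AEMeasurable (markovChain J) (J z) := (markovChain J).measurable.aemeasurable
  have : IsProbabilityMeasure ((J z).bind (markovChain J)) := by infer_instance
  refine (IsChainLaw.eq_markovChain ⟨Measure.isProbabilityMeasure_map hc.aemeasurable, ?_, ?_⟩).symm
  · rw [Measure.map_map (measurable_pi_apply 0) hc]
    change Measure.map (fun _ => z) _ = _
    rw [Measure.map_const, measure_univ, one_smul]
  · intro b F hF
    have hF' : Measurable fun ω : ℕ → S => F (Preorder.frestrictLe (π := fun _ => S) (b + 1) ω) :=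
      hF.comp (hm (b + 1))
    rw [lintegral_map hF' hc, lintegral_map (measurable_step b hF') hc]
    -- The step out of `z` is where the draw from `J z` in the `bind` is used. A later step of the
    -- prepended chain is a step of the chain started from the drawn state `y`, with indices lowered
    -- by one.
    cases b with
    | zero =>
      have hu : ∀ (ω : ℕ → S) (y : S), F (Preorder.frestrictLe (π := fun _ => S) 1
          (Function.update (cons z ω) 1 y))
          = F (Preorder.frestrictLe (π := fun _ => S) 1 (cons z fun _ => y)) := fun ω y => by
        congr 1
        funext i
        obtain ⟨i, hi⟩ := i
        rw [Finset.mem_Iic] at hi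
        obtain rfl | rfl : i = 0 ∨ i = 1 := by omega
        · simp
        · simp
      have hu' : ∀ ω : ℕ → S, F (Preorder.frestrictLe (π := fun _ => S) 1 (cons z ω))
          = F (Preorder.frestrictLe (π := fun _ => S) 1 (cons z fun _ => ω 0)) := fun ω => by
        congr 1
        funext i
        obtain ⟨i, hi⟩ := i
        rw [Finset.mem_Iic] at hi
        obtain rfl | rfl : i = 0 ∨ i = 1 := by omega
        · simp
        · simp
      have hg : Measurable fun y : S =>
          F (Preorder.frestrictLe (π := fun _ => S) 1 (cons z fun _ => y)) :=
        hF'.comp (hc.comp (measurable_pi_lambda _ fun _ => measurable_id))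
      simp only [Nat.zero_add, hu, hu', cons_zero, lintegral_const, measure_univ, mul_one]
      have hg0 : Measurable fun ω : ℕ → S =>
          F (Preorder.frestrictLe (π := fun _ => S) 1 (cons z fun _ => ω 0)) :=
        hg.comp (measurable_pi_apply 0)
      rw [Measure.lintegral_bind hk hg0.aemeasurable]
      refine lintegral_congr fun y => ?_
      rw [← lintegral_map hg (measurable_pi_apply 0), (isChainLaw_markovChain J y).init,
        lintegral_dirac' _ hg]
    | succ b =>
      have h1 : Measurable fun ω : ℕ → S =>
          F (Preorder.frestrictLe (π := fun _ => S) (b + 1 + 1) (cons z ω)) := hF'.comp hc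
      have h2 : Measurable fun ω : ℕ → S => ∫⁻ y, F (Preorder.frestrictLe (π := fun _ => S)
          (b + 1 + 1) (Function.update (cons z ω) (b + 1 + 1) y)) ∂J (cons z ω (b + 1)) :=
        (measurable_step (b + 1) hF').comp hc
      rw [Measure.lintegral_bind hk h1.aemeasurable, Measure.lintegral_bind hk h2.aemeasurable]
      refine lintegral_congr fun y => ?_
      have h3 := (isChainLaw_markovChain J y).step b _ (hF.comp (measurable_consIic (b + 1) z))
      simp only [Function.comp, ← frestrictLe_cons, cons_update] at h3
      exact h3

variable {T lmin lmax : ℝ} [Fact (0 < T)] {H : ℝ → ℝ → ℝ}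

/-- The law of the sequence of post-jump states, from the phase of the event that starts it. -/
def pathKernel (hH : IsRenewalKernel T lmin lmax H) : Kernel (AddCircle T) (ℕ → State T) :=
  chainKernel hH ∘ₖ jumpKernel T H

instance (hH : IsRenewalKernel T lmin lmax H) : IsMarkovKernel (chainKernel hH) := by
  have := hH.isMarkovKernel_jumpKernel
  unfold chainKernel; infer_instance

instance (hH : IsRenewalKernel T lmin lmax H) : IsMarkovKernel (pathKernel hH) := by
  have := hH.isMarkovKernel_jumpKernel
  unfold pathKernel; infer_instance

/-- The jump law depends on the state through its phase alone, so the future after the initial state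
is governed by `pathKernel` at `z.2`. -/
lemma chainKernel_apply (hH : IsRenewalKernel T lmin lmax H) (z : State T) :
    chainKernel hH z = (pathKernel hH z.2).map (cons z) := by
  have := hH.isMarkovKernel_jumpKernel
  have h : chainKernel hH = markovChain ((jumpKernel T H).comap Prod.snd measurable_snd) := rfl
  rw [pathKernel, Kernel.comp_apply, h, markovChain_eq_cons]
  rfl

lemma lintegral_chainKernel (hH : IsRenewalKernel T lmin lmax H) (z : State T)
    {F : (ℕ → State T) → ℝ≥0∞} (hF : Measurable F) :
    ∫⁻ ω, F ω ∂(chainKernel hH z) = ∫⁻ ω, F (cons z ω) ∂(pathKernel hH z.2) := by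
  rw [chainKernel_apply, lintegral_map hF (measurable_cons_left z)]

lemma lintegral_pathKernel (hH : IsRenewalKernel T lmin lmax H) (φ : AddCircle T)
    {F : (ℕ → State T) → ℝ≥0∞} (hF : Measurable F) :
    ∫⁻ ω, F ω ∂(pathKernel hH φ)
      = ∫⁻ z, ∫⁻ ω, F (cons z ω) ∂(pathKernel hH z.2) ∂(jumpKernel T H φ) := by
  rw [pathKernel, Kernel.lintegral_comp _ _ _ hF]
  exact lintegral_congr fun z => lintegral_chainKernel hH z hF

end Chain

/-! ### Bounds on the renewal kernel and its descent to the circle. -/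

section Kernel

variable {T lmin lmax : ℝ} {H : ℝ → ℝ → ℝ}

instance : SFinite volumeNN := by unfold volumeNN; infer_instance

lemma lintegral_volumeNN {g : ℝ≥0 → ℝ≥0∞} (hg : Measurable g) :
    ∫⁻ x, g x ∂volumeNN = ∫⁻ x in Ici (0 : ℝ), g x.toNNReal := by
  rw [volumeNN, lintegral_map hg measurable_real_toNNReal]

lemma lintegral_volumeNN_sub {G : ℝ → ℝ≥0 → ℝ≥0∞} (hG : Measurable (Function.uncurry G)) (t : ℝ) :
    ∫⁻ x : ℝ≥0, G (t - x) x ∂volumeNN = ∫⁻ u in Iic t, G u (t - u).toNNReal := by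
  have hm : Measurable fun x : ℝ≥0 => G (t - x) x :=
    hG.comp ((measurable_const.sub measurable_coe_nnreal_real).prodMk measurable_id)
  rw [lintegral_volumeNN hm, ← lintegral_indicator measurableSet_Ici,
    ← lintegral_indicator measurableSet_Iic, ← lintegral_sub_left_eq_self _ t]
  refine lintegral_congr fun x => ?_
  by_cases hx : 0 ≤ t - x
  · have h : x ≤ t := by linarith
    rw [indicator_of_mem (mem_Ici.mpr hx), indicator_of_mem (mem_Iic.mpr h),
      Real.coe_toNNReal _ hx, sub_sub_cancel]
  · have h : ¬ x ≤ t := by intro h; exact hx (by linarith)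
    rw [indicator_of_notMem (by simpa using hx), indicator_of_notMem (by simpa using h)]

lemma IsRenewalKernel.periodic_zsmul (hH : IsRenewalKernel T lmin lmax H) (k : ℤ) :
    ∀ t u, u ≤ t → H (t + k * T) (u + k * T) = H t u := by
  have hn : ∀ n : ℕ, ∀ t u, u ≤ t → H (t + n * T) (u + n * T) = H t u := by
    intro n
    induction n with
    | zero => simp
    | succ n ih =>
      intro t u h
      have := hH.periodic (t + n * T) (u + n * T) (by linarith)
      rw [← ih t u h, ← this]
      push_cast
      congr 1 <;> ring
  intro t u h
  obtain ⟨n, rfl | rfl⟩ := k.eq_nat_or_neg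
  · exact_mod_cast hn n t u h
  · have := hn n (t - n * T) (u - n * T) (by linarith)
    rw [sub_add_cancel, sub_add_cancel] at this
    rw [this]
    push_cast
    congr 1 <;> ring

lemma IsRenewalKernel.density_periodic (hH : IsRenewalKernel T lmin lmax H) (k : ℤ) {t u : ℝ}
    (h : u ≤ t) : density H (t + k * T) (u + k * T) = density H t u := by
  have h1 := hH.hasDerivWithinAt (t := t + k * T) (u := u + k * T) (by linarith)
  have h2 : HasDerivWithinAt (fun s => H (s + k * T) (u + k * T))
      (-density H (t + k * T) (u + k * T)) (Ici u) t := by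
    have h3 : HasDerivWithinAt (fun s : ℝ => s + k * T) 1 (Ici u) t :=
      (hasDerivWithinAt_id t _).add_const _
    have := h1.scomp (h := fun s : ℝ => s + k * T) t h3 (fun s hs => by
      simpa using hs)
    rw [one_smul] at this
    exact this
  have h4 : HasDerivWithinAt (fun s => H s u) (-density H (t + k * T) (u + k * T)) (Ici u) t :=
    h2.congr (fun s hs => (hH.periodic_zsmul k s u hs).symm) (hH.periodic_zsmul k t u h).symm
  have h5 := (uniqueDiffOn_Ici u t h).eq_deriv _ h4 (hH.hasDerivWithinAt h)
  linarith

lemma IsRenewalKernel.density_le (hH : IsRenewalKernel T lmin lmax H) {t u : ℝ} (h : u ≤ t) :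
    density H t u ≤ lmax * H t u :=
  (div_le_iff₀ (hH.pos h)).mp (hH.rate_le t u h)

lemma IsRenewalKernel.density_pos (hH : IsRenewalKernel T lmin lmax H) {t u : ℝ} (h : u ≤ t) :
    0 < density H t u :=
  (mul_pos hH.lmin_pos (hH.pos h)).trans_le (hH.le_density h)

lemma IsRenewalKernel.lmax_pos (hH : IsRenewalKernel T lmin lmax H) : 0 < lmax :=
  hH.lmin_pos.trans hH.lmin_lt_lmax

/-- Grönwall: since `K ≤ lmax * H`, the function `s ↦ H(s,u) * exp(lmax * (s - u))` is
nondecreasing, and it equals `1` at `s = u`. -/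
lemma IsRenewalKernel.exp_le (hH : IsRenewalKernel T lmin lmax H) {x u : ℝ} (hx : 0 ≤ x) :
    Real.exp (-(lmax * x)) ≤ H (u + x) u := by
  have key : MonotoneOn (fun s => H s u * Real.exp (lmax * (s - u))) (Ici u) := by
    have hd : ∀ s ∈ Ici u, HasDerivWithinAt (fun s => H s u * Real.exp (lmax * (s - u)))
        (-density H s u * Real.exp (lmax * (s - u))
          + H s u * (Real.exp (lmax * (s - u)) * lmax)) (Ici u) s := fun s hs => by
      have h1 := hH.hasDerivWithinAt (t := s) (u := u) hs
      have h2 : HasDerivAt (fun s => Real.exp (lmax * (s - u)))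
          (Real.exp (lmax * (s - u)) * lmax) s := by
        have : HasDerivAt (fun s => lmax * (s - u)) lmax s := by
          simpa using ((hasDerivAt_id s).sub_const u).const_mul lmax
        exact this.exp
      exact h1.mul h2.hasDerivWithinAt
    refine monotoneOn_of_hasDerivWithinAt_nonneg (convex_Ici u)
      (fun s hs => (hd s hs).continuousWithinAt)
      (fun s hs => (hd s (interior_subset hs)).mono interior_subset) fun s hs => ?_
    have h1 := hH.density_le (t := s) (u := u) (interior_subset hs)
    nlinarith [Real.exp_pos (lmax * (s - u))]
  have h := key (self_mem_Ici (a := u)) (show u + x ∈ Ici u from by simpa using hx)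
    (by simpa using hx)
  simp only [sub_self, mul_zero, Real.exp_zero, hH.diag, mul_one, add_sub_cancel_left] at h
  rw [Real.exp_neg, ← one_div, div_le_iff₀ (Real.exp_pos _)]
  exact h

/-- The tail integral of the density is the survival function. -/
lemma IsRenewalKernel.lintegral_density_Ioi (hH : IsRenewalKernel T lmin lmax H) {t u : ℝ}
    (h : u ≤ t) : ∫⁻ s in Ioi t, ENNReal.ofReal (density H s u) = ENNReal.ofReal (H t u) := by
  have hnn : ∀ s ∈ Ioi t, 0 ≤ density H s u := fun s hs =>
    hH.density_nonneg (h.trans (mem_Ioi.mp hs).le)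
  have hd : ∀ s ∈ Ioi t, HasDerivAt (fun s => -H s u) (density H s u) s := fun s hs => by
    have hs' : u < s := h.trans_lt hs
    have := ((hH.hasDerivWithinAt hs'.le).hasDerivAt (Ici_mem_nhds hs')).fun_neg
    rwa [neg_neg] at this
  have hc : ContinuousWithinAt (fun s => -H s u) (Ici t) t :=
    (((hH.contDiffOn u).continuousOn t h).mono (Ici_subset_Ici.mpr h)).neg
  have hl : Tendsto (fun s => -H s u) atTop (𝓝 (-0)) := by
    refine Tendsto.neg (squeeze_zero' (g := fun s => Real.exp (-(lmin * (s - u))))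
      (eventually_ge_atTop u |>.mono fun s hs => (hH.pos hs).le)
      (eventually_ge_atTop u |>.mono fun s hs => ?_) ?_)
    · have := hH.le_exp (x := s - u) (u := u) (by linarith)
      rwa [add_sub_cancel] at this
    · exact Real.tendsto_exp_neg_atTop_nhds_zero.comp
        ((tendsto_atTop_add_const_right _ (-u) tendsto_id).const_mul_atTop hH.lmin_pos)
  have hint := integral_Ioi_of_hasDerivAt_of_nonneg hc hd hnn hl
  have hI := integrableOn_Ioi_deriv_of_nonneg hc hd hnn hl
  rw [← ofReal_integral_eq_lintegral_ofReal hI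
    ((ae_restrict_iff' measurableSet_Ioi).mpr (Eventually.of_forall hnn)), hint]
  simp

lemma IsRenewalKernel.measurable_survival (hH : IsRenewalKernel T lmin lmax H) :
    Measurable fun p : ℝ≥0 × ℝ => H (p.1 + p.2) p.2 := by
  refine (measurable_uncurry_of_continuous_of_measurable
    (u := fun (x : ℝ≥0) (r : ℝ) => H (x + r) r) (fun r => ?_) (fun x => ?_) :)
  · refine (hH.contDiffOn r).continuousOn.comp_continuous (by fun_prop) fun x => ?_
    simp
  · simpa [add_comm] using hH.measurable x x.2

/-- A lower bound for the density of the waiting time before `T`. -/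
def densityFloor (T lmin lmax : ℝ) : ℝ := lmin * Real.exp (-(lmax * T))

lemma IsRenewalKernel.densityFloor_pos (hH : IsRenewalKernel T lmin lmax H) :
    0 < densityFloor T lmin lmax := mul_pos hH.lmin_pos (Real.exp_pos _)

/-- The density of the waiting time after an event of phase `φ`. -/
def waitDensity (T : ℝ) [Fact (0 < T)] (H : ℝ → ℝ → ℝ) (φ : AddCircle T) (x : ℝ≥0) : ℝ≥0∞ :=
  ENNReal.ofReal (density H (x + phaseRep φ) (phaseRep φ))

/-- The survival function of the waiting time after an event of phase `φ`. -/
def waitSurvival (T : ℝ) [Fact (0 < T)] (H : ℝ → ℝ → ℝ) (φ : AddCircle T) (x : ℝ≥0) : ℝ≥0∞ :=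
  ENNReal.ofReal (H (x + phaseRep φ) (phaseRep φ))

variable [hT : Fact (0 < T)]

lemma coe_phaseRep (φ : AddCircle T) : ((phaseRep φ : ℝ) : AddCircle T) = φ :=
  (AddCircle.equivIco T 0).symm_apply_apply φ

lemma exists_phaseRep_coe (t : ℝ) : ∃ k : ℤ, phaseRep (t : AddCircle T) = t + k * T := by
  have h := coe_phaseRep (T := T) (t : AddCircle T)
  rw [← sub_eq_zero, ← AddCircle.coe_sub, AddCircle.coe_eq_zero_iff] at h
  obtain ⟨k, hk⟩ := h
  exact ⟨k, by rw [zsmul_eq_mul] at hk; linarith⟩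

/-- By periodicity of `K`, any representative of the phase may replace the one in `[0, T)`. -/
lemma IsRenewalKernel.waitDensity_coe (hH : IsRenewalKernel T lmin lmax H) (u : ℝ) (x : ℝ≥0) :
    waitDensity T H u x = ENNReal.ofReal (density H (u + x) u) := by
  obtain ⟨k, hk⟩ := exists_phaseRep_coe (T := T) u
  rw [waitDensity, hk, ← hH.density_periodic k (show u ≤ u + x by simp)]
  congr 2
  ring

lemma IsRenewalKernel.waitSurvival_coe (hH : IsRenewalKernel T lmin lmax H) (u : ℝ) (x : ℝ≥0) :
    waitSurvival T H u x = ENNReal.ofReal (H (u + x) u) := by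
  obtain ⟨k, hk⟩ := exists_phaseRep_coe (T := T) u
  rw [waitSurvival, hk, ← hH.periodic_zsmul k _ _ (show u ≤ u + x by simp)]
  congr 2
  ring

lemma IsRenewalKernel.measurable_waitDensity (hH : IsRenewalKernel T lmin lmax H) :
    Measurable (Function.uncurry (waitDensity T H)) := hH.measurable_waitingDensity

lemma IsRenewalKernel.measurable_waitSurvival (hH : IsRenewalKernel T lmin lmax H) :
    Measurable (Function.uncurry (waitSurvival T H)) :=
  (hH.measurable_survival.comp
    (measurable_snd.prodMk (measurable_phaseRep.comp measurable_fst))).ennreal_ofReal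

lemma IsRenewalKernel.waitDensity_ne_zero (hH : IsRenewalKernel T lmin lmax H)
    (φ : AddCircle T) (x : ℝ≥0) : waitDensity T H φ x ≠ 0 := by
  simpa [waitDensity] using hH.density_pos (show phaseRep φ ≤ x + phaseRep φ by simp)

lemma IsRenewalKernel.waitDensity_le (hH : IsRenewalKernel T lmin lmax H)
    (φ : AddCircle T) (x : ℝ≥0) :
    waitDensity T H φ x ≤ ENNReal.ofReal lmax * waitSurvival T H φ x := by
  rw [waitDensity, waitSurvival, ← ENNReal.ofReal_mul hH.lmax_pos.le]
  exact ENNReal.ofReal_le_ofReal (hH.density_le (by simp))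

lemma IsRenewalKernel.le_waitDensity (hH : IsRenewalKernel T lmin lmax H)
    (φ : AddCircle T) (x : ℝ≥0) :
    ENNReal.ofReal lmin * waitSurvival T H φ x ≤ waitDensity T H φ x := by
  rw [waitDensity, waitSurvival, ← ENNReal.ofReal_mul hH.lmin_pos.le]
  exact ENNReal.ofReal_le_ofReal (hH.le_density (by simp))

/-- The Doeblin bound: `K ≥ lmin * H`, and `H` has lost at most the factor `exp(-lmax * T)` by time
`T`. -/
lemma IsRenewalKernel.densityFloor_le (hH : IsRenewalKernel T lmin lmax H)
    (φ : AddCircle T) {x : ℝ≥0} (hx : (x : ℝ) ≤ T) :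
    ENNReal.ofReal (densityFloor T lmin lmax) ≤ waitDensity T H φ x := by
  refine ENNReal.ofReal_le_ofReal (le_trans ?_ (hH.le_density (by simp)))
  refine mul_le_mul_of_nonneg_left ?_ hH.lmin_pos.le
  rw [add_comm]
  refine le_trans (Real.exp_le_exp.mpr ?_) (hH.exp_le x.2)
  have := mul_le_mul_of_nonneg_left hx hH.lmax_pos.le
  change -(lmax * T) ≤ -(lmax * (x : ℝ))
  linarith

/-- Ensures that `1 - c * T`, the ratio of the geometric series of masses below, is nonnegative. -/
lemma IsRenewalKernel.densityFloor_mul_le_one (hH : IsRenewalKernel T lmin lmax H) :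
    densityFloor T lmin lmax * T ≤ 1 := by
  have h0 := hT.out
  have h1 : lmax * T ≤ Real.exp (lmax * T) := by
    have := Real.add_one_le_exp (lmax * T); linarith
  have h2 : lmin * T ≤ lmax * T := mul_le_mul_of_nonneg_right hH.lmin_lt_lmax.le h0.le
  rw [densityFloor, Real.exp_neg, mul_right_comm, ← div_eq_mul_inv, div_le_one (Real.exp_pos _)]
  exact h2.trans h1

lemma IsRenewalKernel.lintegral_waitingKernel (hH : IsRenewalKernel T lmin lmax H)
    (φ : AddCircle T) {g : ℝ≥0 → ℝ≥0∞} (hg : Measurable g) :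
    ∫⁻ x, g x ∂(waitingKernel T H φ) = ∫⁻ x, waitDensity T H φ x * g x ∂volumeNN := by
  rw [waitingKernel, Kernel.withDensity_apply _ hH.measurable_waitingDensity, Kernel.const_apply,
    lintegral_withDensity_eq_lintegral_mul _ hH.measurable_waitingDensity.of_uncurry_left hg]
  rfl

lemma IsRenewalKernel.lintegral_waitDensity (hH : IsRenewalKernel T lmin lmax H)
    (φ : AddCircle T) : ∫⁻ x, waitDensity T H φ x ∂volumeNN = 1 := by
  have := hH.isMarkovKernel_waitingKernel
  have h := hH.lintegral_waitingKernel φ (g := fun _ => 1) measurable_const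
  simpa using h.symm

lemma IsRenewalKernel.lintegral_jumpKernel (hH : IsRenewalKernel T lmin lmax H)
    (φ : AddCircle T) {g : State T → ℝ≥0∞} (hg : Measurable g) :
    ∫⁻ z, g z ∂(jumpKernel T H φ)
      = ∫⁻ x : ℝ≥0, waitDensity T H φ x * g (x, φ + ((x : ℝ) : AddCircle T)) ∂volumeNN := by
  have := hH.isMarkovKernel_waitingKernel
  have hm : Measurable fun p : AddCircle T × ℝ≥0 => g (p.2, p.1 + ((p.2 : ℝ) : AddCircle T)) :=
    hg.comp (measurable_jump (T := T))
  rw [jumpKernel, Kernel.lintegral_map _ measurable_jump _ hg, Kernel.lintegral_id_prod hm]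
  exact hH.lintegral_waitingKernel φ (hm.comp (measurable_prodMk_left (x := φ)))

/-- Translation invariance on the circle. -/
lemma lintegral_circle_shift {G : AddCircle T → ℝ≥0 → ℝ≥0∞}
    (hG : Measurable (Function.uncurry G)) :
    ∫⁻ ψ, ∫⁻ x : ℝ≥0, G (ψ - ((x : ℝ) : AddCircle T)) x ∂volumeNN
      = ∫⁻ φ, ∫⁻ x, G φ x ∂volumeNN := by
  have hc : Measurable fun x : ℝ≥0 => ((x : ℝ) : AddCircle T) :=
    AddCircle.measurable_mk'.comp measurable_coe_nnreal_real
  rw [lintegral_lintegral_swap, lintegral_lintegral_swap hG.aemeasurable]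
  · exact lintegral_congr fun x =>
      lintegral_sub_right_eq_self (fun φ => G φ x) ((x : ℝ) : AddCircle T)
  · exact (hG.comp ((measurable_fst.sub (hc.comp measurable_snd)).prodMk
      measurable_snd)).aemeasurable

end Kernel

/-! ### The operator on phase densities and its fixed point. -/

section PhaseOperator

variable {T lmin lmax : ℝ} {H : ℝ → ℝ → ℝ}

lemma measurable_coe_circle : Measurable fun x : ℝ≥0 => ((x : ℝ) : AddCircle T) :=
  AddCircle.measurable_mk'.comp measurable_coe_nnreal_real

lemma measurable_sub_coe :
    Measurable fun p : AddCircle T × ℝ≥0 => (p.1 - ((p.2 : ℝ) : AddCircle T), p.2) :=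
  (measurable_fst.sub (measurable_coe_circle.comp measurable_snd)).prodMk measurable_snd

/-- The action of the kernel `W` on densities on the circle. -/
def convolve (W : AddCircle T → ℝ≥0 → ℝ≥0∞) (f : AddCircle T → ℝ≥0∞) (ψ : AddCircle T) : ℝ≥0∞ :=
  ∫⁻ x : ℝ≥0, W (ψ - ((x : ℝ) : AddCircle T)) x * f (ψ - ((x : ℝ) : AddCircle T)) ∂volumeNN

lemma measurable_mul_fst {W : AddCircle T → ℝ≥0 → ℝ≥0∞} (hW : Measurable (Function.uncurry W))
    {f : AddCircle T → ℝ≥0∞} (hf : Measurable f) :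
    Measurable (Function.uncurry fun φ x => W φ x * f φ) :=
  hW.mul (hf.comp measurable_fst)

lemma measurable_convolve_integrand {W : AddCircle T → ℝ≥0 → ℝ≥0∞}
    (hW : Measurable (Function.uncurry W)) {f : AddCircle T → ℝ≥0∞} (hf : Measurable f)
    (ψ : AddCircle T) : Measurable fun x : ℝ≥0 =>
      W (ψ - ((x : ℝ) : AddCircle T)) x * f (ψ - ((x : ℝ) : AddCircle T)) :=
  ((measurable_mul_fst hW hf).comp measurable_sub_coe).comp (measurable_prodMk_left (x := ψ))

lemma measurable_convolve {W : AddCircle T → ℝ≥0 → ℝ≥0∞} (hW : Measurable (Function.uncurry W))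
    {f : AddCircle T → ℝ≥0∞} (hf : Measurable f) : Measurable (convolve W f) := by
  have h := (measurable_mul_fst hW hf).comp measurable_sub_coe
  exact Measurable.lintegral_prod_right' (ν := volumeNN) h

variable [hT : Fact (0 < T)]

/-- Tonelli and translation invariance. It yields conservation of mass when `W` is the waiting
density, and the mean waiting time when `W` is the survival function. -/
lemma lintegral_convolve {W : AddCircle T → ℝ≥0 → ℝ≥0∞} (hW : Measurable (Function.uncurry W))
    {f : AddCircle T → ℝ≥0∞} (hf : Measurable f) :
    ∫⁻ ψ, convolve W f ψ = ∫⁻ φ, (∫⁻ x, W φ x ∂volumeNN) * f φ := by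
  have h := lintegral_circle_shift (measurable_mul_fst hW hf)
  refine h.trans (lintegral_congr fun φ => ?_)
  rw [lintegral_mul_const _ hW.of_uncurry_left]

omit hT in
lemma convolve_tsum {W : AddCircle T → ℝ≥0 → ℝ≥0∞} (hW : Measurable (Function.uncurry W))
    {g : ℕ → AddCircle T → ℝ≥0∞} (hg : ∀ n, Measurable (g n)) (ψ : AddCircle T) :
    convolve W (fun φ => ∑' n, g n φ) ψ = ∑' n, convolve W (g n) ψ := by
  unfold convolve
  rw [← lintegral_tsum]
  · simp_rw [ENNReal.tsum_mul_left]
  · intro n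
    exact (measurable_convolve_integrand hW (hg n) ψ).aemeasurable

/-- As `x` runs over `[0, T)`, the point `ψ - x` runs once around the circle. This turns the uniform
part of the waiting density into `f ↦ ∫ f`, and statements about almost every `x` into statements
about almost every phase. -/
lemma lintegral_sub_coe_Ico {f : AddCircle T → ℝ≥0∞} (hf : Measurable f) (ψ : AddCircle T) :
    ∫⁻ x : ℝ≥0, ({x : ℝ≥0 | (x : ℝ) < T}.indicator 1 x) * f (ψ - ((x : ℝ) : AddCircle T)) ∂volumeNN
      = ∫⁻ φ, f φ := by
  obtain ⟨t, rfl⟩ := QuotientAddGroup.mk_surjective ψ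
  have hs : MeasurableSet {x : ℝ≥0 | (x : ℝ) < T} := measurable_coe_nnreal_real measurableSet_Iio
  have hG : Measurable (Function.uncurry fun (u : ℝ) (x : ℝ≥0) =>
      ({x : ℝ≥0 | (x : ℝ) < T}.indicator 1 x) * f (u : AddCircle T)) :=
    ((measurable_one.indicator hs).comp measurable_snd).mul
      (hf.comp (AddCircle.measurable_mk'.comp measurable_fst))
  have h := lintegral_volumeNN_sub hG t
  refine Eq.trans ?_ (h.trans ?_)
  · rfl
  · rw [← AddCircle.lintegral_preimage T (t - T) f, sub_add_cancel,
      ← lintegral_indicator measurableSet_Iic, ← lintegral_indicator measurableSet_Ioc]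
    refine lintegral_congr fun u => ?_
    by_cases h1 : u ≤ t
    · have h3 : ((t - u).toNNReal : ℝ) = t - u := Real.coe_toNNReal _ (by linarith)
      by_cases h2 : t - T < u
      · rw [indicator_of_mem (mem_Iic.mpr h1), indicator_of_mem (show u ∈ Ioc (t - T) t from ⟨h2, h1⟩),
          indicator_of_mem (by simp only [mem_ofPred_eq, h3]; linarith)]
        simp
      · rw [indicator_of_mem (mem_Iic.mpr h1), indicator_of_notMem (show u ∉ Ioc (t - T) t from fun h => h2 h.1),
          indicator_of_notMem (by simp only [mem_ofPred_eq, h3]; linarith), zero_mul]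
    · rw [indicator_of_notMem (by simpa using h1), indicator_of_notMem (fun h => h1 h.2)]

/-- The waiting density with its uniform part on `[0, T)` removed. -/
def reducedDensity (T lmin lmax : ℝ) [Fact (0 < T)] (H : ℝ → ℝ → ℝ) (φ : AddCircle T) (x : ℝ≥0) :
    ℝ≥0∞ :=
  waitDensity T H φ x
    - ENNReal.ofReal (densityFloor T lmin lmax) * {x : ℝ≥0 | (x : ℝ) < T}.indicator 1 x

lemma IsRenewalKernel.reducedDensity_add (hH : IsRenewalKernel T lmin lmax H) (φ : AddCircle T)
    (x : ℝ≥0) : reducedDensity T lmin lmax H φ x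
      + ENNReal.ofReal (densityFloor T lmin lmax) * {x : ℝ≥0 | (x : ℝ) < T}.indicator 1 x
      = waitDensity T H φ x := by
  refine tsub_add_cancel_of_le ?_
  by_cases hx : (x : ℝ) < T
  · rw [indicator_of_mem (by exact hx), Pi.one_apply, mul_one]
    exact hH.densityFloor_le φ hx.le
  · rw [indicator_of_notMem (by exact hx), mul_zero]
    exact zero_le

lemma measurable_indicator_lt (T : ℝ) :
    Measurable ({x : ℝ≥0 | (x : ℝ) < T}.indicator (1 : ℝ≥0 → ℝ≥0∞)) :=
  measurable_one.indicator (measurable_coe_nnreal_real measurableSet_Iio)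

lemma IsRenewalKernel.measurable_reducedDensity (hH : IsRenewalKernel T lmin lmax H) :
    Measurable (Function.uncurry (reducedDensity T lmin lmax H)) :=
  hH.measurable_waitDensity.sub
    (((measurable_indicator_lt T).comp measurable_snd).const_mul _)

/-- The Doeblin splitting into `R` and a rank-one operator with constant image. -/
lemma IsRenewalKernel.convolve_waitDensity (hH : IsRenewalKernel T lmin lmax H)
    {f : AddCircle T → ℝ≥0∞} (hf : Measurable f) (ψ : AddCircle T) :
    convolve (waitDensity T H) f ψ = convolve (reducedDensity T lmin lmax H) f ψ
      + ENNReal.ofReal (densityFloor T lmin lmax) * ∫⁻ φ, f φ := by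
  have hm1 := measurable_convolve_integrand hH.measurable_reducedDensity hf ψ
  have h := lintegral_add_left (μ := volumeNN) hm1 fun x : ℝ≥0 =>
    ENNReal.ofReal (densityFloor T lmin lmax)
      * ({x : ℝ≥0 | (x : ℝ) < T}.indicator 1 x * f (ψ - ((x : ℝ) : AddCircle T)))
  rw [lintegral_const_mul' _ _ ENNReal.ofReal_ne_top, lintegral_sub_coe_Ico hf ψ] at h
  refine Eq.trans (lintegral_congr fun x => ?_) h
  rw [← hH.reducedDensity_add, add_mul, mul_assoc]

lemma IsRenewalKernel.lintegral_convolve_waitDensity (hH : IsRenewalKernel T lmin lmax H)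
    {f : AddCircle T → ℝ≥0∞} (hf : Measurable f) :
    ∫⁻ ψ, convolve (waitDensity T H) f ψ = ∫⁻ φ, f φ := by
  rw [lintegral_convolve hH.measurable_waitDensity hf]
  simp_rw [hH.lintegral_waitDensity, one_mul]

/-- There is an invariant density for the phases of the events. -/
lemma IsRenewalKernel.exists_invariant_density (hH : IsRenewalKernel T lmin lmax H) :
    ∃ f : AddCircle T → ℝ≥0∞, Measurable f ∧ (∀ ψ, convolve (waitDensity T H) f ψ = f ψ) ∧
      (∀ ψ, 1 ≤ f ψ) ∧ ∫⁻ φ, f φ ≠ ∞ := by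
  set c := densityFloor T lmin lmax with hc
  have hc0 : 0 < c := hH.densityFloor_pos
  have hT0 := hT.out
  have hcT : 0 < c * T := mul_pos hc0 hT0
  have hcT1 : c * T ≤ 1 := hH.densityFloor_mul_le_one
  -- `g n = Rⁿ 1`, where `R` is the reduced operator; the fixed point is the sum of the `g n`.
  let g : ℕ → AddCircle T → ℝ≥0∞ := fun n => (convolve (reducedDensity T lmin lmax H))^[n] 1
  have hgs : ∀ n, g (n + 1) = convolve (reducedDensity T lmin lmax H) (g n) := fun n =>
    Function.iterate_succ_apply' _ _ _
  have hg : ∀ n, Measurable (g n) := by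
    intro n
    induction n with
    | zero => exact measurable_one
    | succ n ih => rw [hgs]; exact measurable_convolve hH.measurable_reducedDensity ih
  -- The full operator keeps the mass of `g n`, and its rank-one part takes the fraction `c * T` of
  -- it, so `R` keeps the fraction `1 - c * T`.
  have hmass : ∀ n, ∫⁻ φ, g n φ = ENNReal.ofReal (T * (1 - c * T) ^ n) := by
    intro n
    induction n with
    | zero => simp [g]
    | succ n ih =>
      have h1 := hH.lintegral_convolve_waitDensity (hg n)
      simp_rw [hH.convolve_waitDensity (hg n), ← hgs] at h1
      rw [lintegral_add_right _ measurable_const, lintegral_const, AddCircle.measure_univ, ih,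
        ← ENNReal.ofReal_mul hc0.le, ← ENNReal.ofReal_mul (by positivity)] at h1
      have hr : 0 ≤ (1 - c * T) ^ n := pow_nonneg (by linarith) _
      refine (ENNReal.eq_sub_of_add_eq ENNReal.ofReal_ne_top h1).trans ?_
      rw [← ENNReal.ofReal_sub _ (by positivity)]
      congr 1
      ring
  have hgeom : HasSum (fun n : ℕ => T * (1 - c * T) ^ n) (T * (1 - (1 - c * T))⁻¹) :=
    (hasSum_geometric_of_lt_one (by linarith) (by linarith)).mul_left T
  have hsum : ∑' n, ∫⁻ φ, g n φ = ENNReal.ofReal (1 / c) := by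
    simp_rw [hmass]
    rw [← ENNReal.ofReal_tsum_of_nonneg (fun n => mul_nonneg hT0.le (pow_nonneg (by linarith) _))
      hgeom.summable, hgeom.tsum_eq]
    congr 1
    field_simp
    ring
  refine ⟨fun φ => ∑' n, g n φ, Measurable.tsum hg, fun ψ => ?_, fun ψ => ?_, ?_⟩
  -- The reduced part sends the series to its tail from `n = 1`. The rank-one part contributes `c *
  -- (1 / c) = 1`, which is the missing term `g 0`.
  · rw [convolve_tsum hH.measurable_waitDensity hg]
    simp_rw [hH.convolve_waitDensity (hg _), ← hgs]
    rw [ENNReal.tsum_add, ENNReal.tsum_mul_left, hsum, ← hc, ← ENNReal.ofReal_mul hc0.le,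
      mul_one_div_cancel hc0.ne', ENNReal.ofReal_one,
      tsum_eq_zero_add' (f := fun n => g n ψ) ENNReal.summable, add_comm]
    rfl
  · exact ENNReal.le_tsum (f := fun n => g n ψ) 0
  · rw [lintegral_tsum fun n => (hg n).aemeasurable, hsum]
    exact ENNReal.ofReal_ne_top

end PhaseOperator

/-! ### Lifting to the real line; constancy of the normalization. -/

section RealLine

variable {T lmin lmax : ℝ} {H : ℝ → ℝ → ℝ} [hT : Fact (0 < T)]

lemma ae_coe_circle {p : AddCircle T → Prop} (hp : ∀ᵐ φ, p φ) : ∀ᵐ t : ℝ, p (t : AddCircle T) := by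
  have hU : (⋃ n : ℤ, Ioc (n • T) ((n + 1) • T)) = univ := iUnion_Ioc_zsmul hT.out
  rw [← Measure.restrict_univ (μ := (volume : Measure ℝ)), ← hU, ae_restrict_iUnion_iff]
  intro n
  have h := (AddCircle.measurePreserving_mk T (n • T)).quasiMeasurePreserving.ae hp
  rwa [add_zsmul, one_zsmul]

omit hT in
lemma convolve_coe {W : AddCircle T → ℝ≥0 → ℝ≥0∞} (hW : Measurable (Function.uncurry W))
    {f : AddCircle T → ℝ≥0∞} (hf : Measurable f) (t : ℝ) :
    convolve W f t = ∫⁻ u in Iic t, W u (t - u).toNNReal * f u := by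
  have hG : Measurable (Function.uncurry fun (u : ℝ) (x : ℝ≥0) =>
      W (u : AddCircle T) x * f (u : AddCircle T)) :=
    (measurable_mul_fst hW hf).comp
      ((AddCircle.measurable_mk'.comp measurable_fst).prodMk measurable_snd)
  exact lintegral_volumeNN_sub hG t

/-- Upgrades almost everywhere to everywhere: each value of the convolution is an integral, which
does not see null sets of `f`. -/
lemma convolve_eq_zero {W : AddCircle T → ℝ≥0 → ℝ≥0∞} (hW : Measurable (Function.uncurry W))
    {f : AddCircle T → ℝ≥0∞} (hf : Measurable f) (h0 : ∀ᵐ φ, f φ = 0) (ψ : AddCircle T) :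
    convolve W f ψ = 0 := by
  obtain ⟨t, rfl⟩ := QuotientAddGroup.mk_surjective ψ
  refine (convolve_coe hW hf t).trans ?_
  refine (lintegral_congr_ae (ae_restrict_of_ae ?_)).trans lintegral_zero
  filter_upwards [ae_coe_circle h0] with u hu
  rw [hu, mul_zero]

lemma IsRenewalKernel.convolve_waitDensity_coe (hH : IsRenewalKernel T lmin lmax H)
    {f : AddCircle T → ℝ≥0∞} (hf : Measurable f) (t : ℝ) :
    convolve (waitDensity T H) f t = ∫⁻ u in Iic t, ENNReal.ofReal (density H t u) * f u := by
  rw [convolve_coe hH.measurable_waitDensity hf]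
  refine setLIntegral_congr_fun measurableSet_Iic fun u hu => ?_
  have : 0 ≤ t - u := sub_nonneg.mpr hu
  simp only [hH.waitDensity_coe, Real.coe_toNNReal _ this, add_sub_cancel]

lemma IsRenewalKernel.convolve_waitSurvival_coe (hH : IsRenewalKernel T lmin lmax H)
    {f : AddCircle T → ℝ≥0∞} (hf : Measurable f) (t : ℝ) :
    convolve (waitSurvival T H) f t = ∫⁻ u in Iic t, ENNReal.ofReal (H t u) * f u := by
  rw [convolve_coe hH.measurable_waitSurvival hf]
  refine setLIntegral_congr_fun measurableSet_Iic fun u hu => ?_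
  have : 0 ≤ t - u := sub_nonneg.mpr hu
  simp only [hH.waitSurvival_coe, Real.coe_toNNReal _ this, add_sub_cancel]

/-- The density `K(s,u)`, extended by zero to `s ≤ u`. -/
def extDensity (H : ℝ → ℝ → ℝ) (s u : ℝ) : ℝ≥0∞ :=
  if u < s then ENNReal.ofReal (density H s u) else 0

omit hT in
lemma IsRenewalKernel.measurable_extDensity (hH : IsRenewalKernel T lmin lmax H) :
    Measurable (Function.uncurry (extDensity H)) := by
  have h1 : Measurable fun p : ℝ × ℝ =>
      ENNReal.ofReal (density H (((p.1 - p.2).toNNReal : ℝ) + p.2) p.2) :=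
    (hH.measurable_density.comp (((measurable_fst.sub measurable_snd).real_toNNReal).prodMk
      measurable_snd)).ennreal_ofReal
  have h2 : Function.uncurry (extDensity H) = fun p : ℝ × ℝ => if p.2 < p.1 then
      ENNReal.ofReal (density H (((p.1 - p.2).toNNReal : ℝ) + p.2) p.2) else 0 := by
    funext p
    simp only [Function.uncurry, extDensity]
    split_ifs with h
    · rw [Real.coe_toNNReal _ (by linarith), sub_add_cancel]
    · rfl
  rw [h2]
  exact Measurable.ite (measurableSet_lt measurable_snd measurable_fst) h1 measurable_const

omit hT in
lemma IsRenewalKernel.lintegral_extDensity (hH : IsRenewalKernel T lmin lmax H) (t u : ℝ) :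
    ∫⁻ s in Ioi t, extDensity H s u = ENNReal.ofReal (H (max t u) u) := by
  rw [← hH.lintegral_density_Ioi (le_max_right t u), ← lintegral_indicator measurableSet_Ioi,
    ← lintegral_indicator measurableSet_Ioi]
  refine lintegral_congr fun s => ?_
  by_cases h1 : t < s
  · by_cases h2 : u < s
    · rw [indicator_of_mem (mem_Ioi.mpr h1), indicator_of_mem (mem_Ioi.mpr (max_lt h1 h2)),
        extDensity, if_pos h2]
    · rw [indicator_of_mem (mem_Ioi.mpr h1), extDensity, if_neg h2, indicator_of_notMem]
      exact fun h => h2 (lt_of_le_of_lt (le_max_right _ _) h)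
  · rw [indicator_of_notMem (by simpa using h1), indicator_of_notMem]
    exact fun h => h1 (lt_of_le_of_lt (le_max_left _ _) h)

/-- The normalization `∫ H(t,u) f(u) du` of an invariant density does not depend on `t`. -/
lemma IsRenewalKernel.convolve_waitSurvival_const (hH : IsRenewalKernel T lmin lmax H)
    {f : AddCircle T → ℝ≥0∞} (hf : Measurable f) (hfix : ∀ ψ, convolve (waitDensity T H) f ψ = f ψ)
    (hfin : ∫⁻ φ, f φ ≠ ∞) (ψ ψ' : AddCircle T) :
    convolve (waitSurvival T H) f ψ = convolve (waitSurvival T H) f ψ' := by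
  have hF : Measurable fun u : ℝ => f (u : AddCircle T) := hf.comp AddCircle.measurable_mk'
  have hkm := hH.measurable_extDensity
  have hkF : Measurable (Function.uncurry fun s u : ℝ => extDensity H s u * f (u : AddCircle T)) :=
    hkm.mul (hF.comp measurable_snd)
  have hkF' : Measurable (Function.uncurry fun u s : ℝ =>
      extDensity H s u * f (u : AddCircle T)) := hkF.comp measurable_swap
  have hin : ∀ t u : ℝ, ∫⁻ s in Ioi t, extDensity H s u * f u
      = ENNReal.ofReal (H (max t u) u) * f u := fun t u => by
    have h : Measurable fun s => extDensity H s u := hkm.comp measurable_prodMk_right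
    rw [lintegral_mul_const _ h, hH.lintegral_extDensity]
  have key : ∀ t t' : ℝ, t ≤ t' → t' ≤ t + T →
      convolve (waitSurvival T H) f (t : AddCircle T)
        = convolve (waitSurvival T H) f (t' : AddCircle T) := by
    intro t t' h1 h2
    -- This mass is cancelled at the end, so it must be finite; `t' ≤ t + T` bounds it by the mass
    -- of one period.
    have hfin' : ∫⁻ u in Ioc t t', f (u : AddCircle T) ≠ ∞ := by
      refine ne_top_of_le_ne_top hfin ?_
      rw [← AddCircle.lintegral_preimage T t f]
      exact lintegral_mono_set (Ioc_subset_Ioc_right h2)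
    -- The integral counts pairs (event at `u ≤ t'`, next event at `s > t`). Integrating in `s`
    -- first, an event before `t` contributes its survival `H t u`, and one in `(t, t']` contributes
    -- `H u u = 1`.
    have e1 : ∫⁻ u in Iic t', ∫⁻ s in Ioi t, extDensity H s u * f u
        = convolve (waitSurvival T H) f (t : AddCircle T)
          + ∫⁻ u in Ioc t t', f (u : AddCircle T) := by
      simp_rw [hin]
      rw [← Iic_union_Ioc_eq_Iic h1, lintegral_union measurableSet_Ioc
        (Iic_disjoint_Ioc le_rfl), hH.convolve_waitSurvival_coe hf]
      congr 1
      · exact setLIntegral_congr_fun measurableSet_Iic fun u hu => by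
          simp only [max_eq_left (mem_Iic.mp hu)]
      · exact setLIntegral_congr_fun measurableSet_Ioc fun u hu => by
          simp only [max_eq_right hu.1.le, hH.diag, ENNReal.ofReal_one, one_mul]
    -- The same pairs sorted by `s`: those with `s > t'` give the survival integral at `t'`, and
    -- those with `s ∈ (t, t']` give `f s` by the fixed-point equation.
    have e2 : ∫⁻ u in Iic t', ∫⁻ s in Ioi t, extDensity H s u * f u
        = convolve (waitSurvival T H) f (t' : AddCircle T)
          + ∫⁻ u in Ioc t t', f (u : AddCircle T) := by
      rw [lintegral_lintegral_swap hkF'.aemeasurable,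
        ← Ioc_union_Ioi_eq_Ioi h1, lintegral_union measurableSet_Ioi
        (Ioc_disjoint_Ioi le_rfl), add_comm]
      congr 1
      · rw [← lintegral_lintegral_swap hkF'.aemeasurable]
        simp_rw [hin]
        rw [hH.convolve_waitSurvival_coe hf]
        exact setLIntegral_congr_fun measurableSet_Iic fun u hu => by
          simp only [max_eq_left (mem_Iic.mp hu)]
      · refine setLIntegral_congr_fun measurableSet_Ioc fun s hs => ?_
        rw [← hfix, hH.convolve_waitDensity_coe hf, setLIntegral_congr (Iio_ae_eq_Iic (a := s)).symm,
          ← lintegral_indicator measurableSet_Iic, ← lintegral_indicator measurableSet_Iio]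
        refine lintegral_congr fun u => ?_
        by_cases hu : u < s
        · rw [indicator_of_mem (mem_Iic.mpr (hu.le.trans hs.2)), indicator_of_mem (mem_Iio.mpr hu),
            extDensity, if_pos hu]
        · rw [indicator_of_notMem (show u ∉ Iio s from hu), indicator_apply, extDensity, if_neg hu,
            zero_mul, ite_self]
    exact (ENNReal.add_left_inj hfin').mp (e1.symm.trans e2)
  have hmem : ∀ φ : AddCircle T, phaseRep φ ∈ Ico (0 : ℝ) T := fun φ => by
    have h := mem_Ico.mp (AddCircle.equivIco T 0 φ).2
    exact ⟨h.1, h.2.trans_eq (zero_add T)⟩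
  have h := hmem ψ
  have h' := hmem ψ'
  rw [← coe_phaseRep ψ, ← coe_phaseRep ψ']
  rcases le_total (phaseRep ψ) (phaseRep ψ') with hle | hle
  · exact key _ _ hle (by linarith [h.1, h'.2])
  · exact (key _ _ hle (by linarith [h'.1, h.2])).symm

lemma IsRenewalKernel.convolve_waitDensity_le (hH : IsRenewalKernel T lmin lmax H)
    {f : AddCircle T → ℝ≥0∞} (ψ : AddCircle T) :
    convolve (waitDensity T H) f ψ ≤ ENNReal.ofReal lmax * convolve (waitSurvival T H) f ψ := by
  rw [convolve, convolve, ← lintegral_const_mul' _ _ ENNReal.ofReal_ne_top]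
  refine lintegral_mono fun x => ?_
  rw [← mul_assoc]
  exact mul_le_mul_left (hH.waitDensity_le _ _) _

lemma IsRenewalKernel.le_convolve_waitDensity (hH : IsRenewalKernel T lmin lmax H)
    {f : AddCircle T → ℝ≥0∞} (ψ : AddCircle T) :
    ENNReal.ofReal lmin * convolve (waitSurvival T H) f ψ ≤ convolve (waitDensity T H) f ψ := by
  rw [convolve, convolve, ← lintegral_const_mul' _ _ ENNReal.ofReal_ne_top]
  refine lintegral_mono fun x => ?_
  rw [← mul_assoc]
  exact mul_le_mul_left (hH.le_waitDensity _ _) _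

end RealLine

/-! ### Existence and uniqueness of the stationary intensity. -/

section Intensity

variable {T lmin lmax : ℝ} {H : ℝ → ℝ → ℝ}

lemma IsRenewalKernel.aestronglyMeasurable_density (hH : IsRenewalKernel T lmin lmax H) (t : ℝ) :
    AEStronglyMeasurable (fun u => density H t u) (volume.restrict (Iic t)) := by
  have h : Measurable fun u : ℝ => density H (((t - u).toNNReal : ℝ) + u) u :=
    hH.measurable_density.comp (((measurable_const.sub measurable_id).real_toNNReal).prodMk
      measurable_id)
  refine h.aestronglyMeasurable.congr ((ae_restrict_mem measurableSet_Iic).mono fun u hu => ?_)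
  have : 0 ≤ t - u := sub_nonneg.mpr hu
  simp only [Real.coe_toNNReal _ this, sub_add_cancel]

lemma IsRenewalKernel.aestronglyMeasurable_survival (hH : IsRenewalKernel T lmin lmax H) (t : ℝ) :
    AEStronglyMeasurable (fun u => H t u) (volume.restrict (Iic t)) := by
  have h : Measurable fun u : ℝ => H (((t - u).toNNReal : ℝ) + u) u :=
    hH.measurable_survival.comp (((measurable_const.sub measurable_id).real_toNNReal).prodMk
      measurable_id)
  refine h.aestronglyMeasurable.congr ((ae_restrict_mem measurableSet_Iic).mono fun u hu => ?_)
  have : 0 ≤ t - u := sub_nonneg.mpr hu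
  simp only [Real.coe_toNNReal _ this, sub_add_cancel]

variable [hT : Fact (0 < T)]

/-- A `T`-periodic function, integrable over a period, fixed by the operator of kernel `K`. -/
structure IsInvariantIntensity (T : ℝ) (H : ℝ → ℝ → ℝ) (d : ℝ → ℝ) : Prop where
  periodic : Function.Periodic d T
  integrable : IntegrableOn d (Ioc 0 T)
  eq_integral : ∀ t, d t = ∫ u in Iic t, density H t u * d u

omit hT in
lemma IsStationaryIntensity.isInvariantIntensity {ρ : ℝ → ℝ} (hρ : IsStationaryIntensity T H ρ) :
    IsInvariantIntensity T H ρ := ⟨hρ.periodic, hρ.integrable, hρ.eq_integral⟩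

omit hT in
lemma IsInvariantIntensity.neg {d : ℝ → ℝ} (hd : IsInvariantIntensity T H d) :
    IsInvariantIntensity T H (fun t => -d t) where
  periodic t := by simp only [hd.periodic t]
  integrable := hd.integrable.neg
  eq_integral t := by simp only [mul_neg, integral_neg, ← hd.eq_integral t]

/-- Integrability over a period gives only a.e. measurability. The equation then writes `d` as the
integral of a jointly measurable kernel against a measurable version of `d`. -/
lemma IsInvariantIntensity.measurable (hH : IsRenewalKernel T lmin lmax H) {d : ℝ → ℝ}
    (hd : IsInvariantIntensity T H d) : Measurable d := by
  have hT0 := hT.out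
  have hae : AEStronglyMeasurable d volume := by
    have hi : IntervalIntegrable d volume 0 T :=
      (intervalIntegrable_iff_integrableOn_Ioc_of_le hT0.le).mpr hd.integrable
    have hU : (⋃ n : ℤ, Ioc (n • T) ((n + 1) • T)) = univ := iUnion_Ioc_zsmul hT0
    rw [← Measure.restrict_univ (μ := (volume : Measure ℝ)), ← hU, aestronglyMeasurable_iUnion_iff]
    exact fun n => (hd.periodic.intervalIntegrable₀ hT0.ne' hi _ _).1.aestronglyMeasurable
  obtain ⟨d', hd'm, hd'⟩ := hae
  have hkm : Measurable fun p : ℝ × ℝ => (extDensity H p.1 p.2).toReal * d' p.2 :=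
    hH.measurable_extDensity.ennreal_toReal.mul (hd'm.measurable.comp measurable_snd)
  have h := (hkm.stronglyMeasurable.integral_prod_right' (ν := (volume : Measure ℝ))).measurable
  have e : d = fun t => ∫ u, (extDensity H t u).toReal * d' u := by
    funext t
    rw [hd.eq_integral t, setIntegral_congr_set Iio_ae_eq_Iic.symm,
      ← integral_indicator measurableSet_Iio]
    refine integral_congr_ae (hd'.mono fun u hu => ?_)
    simp only
    by_cases hut : u < t
    · rw [indicator_of_mem (mem_Iio.mpr hut), extDensity, if_pos hut, hu,
        ENNReal.toReal_ofReal (hH.density_nonneg hut.le)]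
    · rw [indicator_of_notMem (by simpa using hut), extDensity, if_neg hut]
      simp
  rw [e]
  exact h

/-- The positive part of a function, as a function on the circle. -/
def circlePart (T : ℝ) [Fact (0 < T)] (d : ℝ → ℝ) (φ : AddCircle T) : ℝ≥0∞ :=
  ENNReal.ofReal (d (phaseRep φ))

lemma circlePart_coe {d : ℝ → ℝ} (hd : Function.Periodic d T) (t : ℝ) :
    circlePart T d t = ENNReal.ofReal (d t) := by
  obtain ⟨k, hk⟩ := exists_phaseRep_coe (T := T) t
  rw [circlePart, hk]
  have := hd.zsmul k t
  rw [zsmul_eq_mul] at this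
  rw [this]

lemma measurable_circlePart {d : ℝ → ℝ} (hd : Measurable d) : Measurable (circlePart T d) :=
  (hd.comp measurable_phaseRep).ennreal_ofReal

lemma lintegral_circlePart_ne_top {d : ℝ → ℝ} (hp : Function.Periodic d T)
    (hi : IntegrableOn d (Ioc 0 T)) : ∫⁻ φ, circlePart T d φ ≠ ∞ := by
  rw [← AddCircle.lintegral_preimage T 0, zero_add]
  simp_rw [circlePart_coe hp]
  exact hi.lintegral_lt_top.ne

omit hT in
-- The right side is the integral of the positive part of `g`. No integrability is required, since
-- the Bochner integral defaults to `0`.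
lemma ofReal_integral_le {α : Type*} [MeasurableSpace α] (μ : Measure α) (g : α → ℝ) :
    ENNReal.ofReal (∫ x, g x ∂μ) ≤ ∫⁻ x, ENNReal.ofReal (g x) ∂μ := by
  by_cases hg : Integrable g μ
  · have h1 : ∫ x, g x ∂μ ≤ ∫ x, max (g x) 0 ∂μ :=
      integral_mono hg hg.pos_part fun x => le_max_left _ _
    refine (ENNReal.ofReal_le_ofReal h1).trans ?_
    rw [ofReal_integral_eq_lintegral_ofReal hg.pos_part (ae_of_all _ fun x => le_max_right _ _)]
    exact (lintegral_congr fun x => by simp [ENNReal.ofReal_max]).le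
  · rw [integral_undef hg, ENNReal.ofReal_zero]
    exact zero_le

/-- A positive operator satisfies `(𝒦d)⁺ ≤ 𝒦d⁺`, here at every point. -/
lemma IsInvariantIntensity.circlePart_le (hH : IsRenewalKernel T lmin lmax H) {d : ℝ → ℝ}
    (hd : IsInvariantIntensity T H d) (ψ : AddCircle T) :
    circlePart T d ψ ≤ convolve (waitDensity T H) (circlePart T d) ψ := by
  obtain ⟨t, rfl⟩ := QuotientAddGroup.mk_surjective ψ
  refine (circlePart_coe hd.periodic t).trans_le ?_
  refine le_of_le_of_eq ?_
    (hH.convolve_waitDensity_coe (measurable_circlePart (hd.measurable hH)) t).symm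
  rw [hd.eq_integral t]
  refine (ofReal_integral_le _ _).trans (setLIntegral_mono_ae' measurableSet_Iic (ae_of_all _ ?_))
  intro u hu
  rw [circlePart_coe hd.periodic, ENNReal.ofReal_mul (hH.density_nonneg hu)]

/-- Irreducibility in one step: the waiting density never vanishes, so `f (ψ - x) = 0` for almost
every `x`, and `x ∈ [0, T)` already covers the circle. -/
lemma IsRenewalKernel.ae_eq_zero_of_convolve_eq_zero (hH : IsRenewalKernel T lmin lmax H)
    {f : AddCircle T → ℝ≥0∞} (hf : Measurable f) {ψ : AddCircle T}
    (h : convolve (waitDensity T H) f ψ = 0) : ∀ᵐ φ, f φ = 0 := by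
  have h1 := (lintegral_eq_zero_iff
    (measurable_convolve_integrand hH.measurable_waitDensity hf ψ)).mp h
  have h2 := lintegral_sub_coe_Ico hf ψ
  refine (lintegral_eq_zero_iff hf).mp (h2.symm.trans ?_)
  refine (lintegral_congr_ae (h1.mono fun x hx => ?_)).trans lintegral_zero
  have : f (ψ - ((x : ℝ) : AddCircle T)) = 0 :=
    (mul_eq_zero.mp hx).resolve_left (hH.waitDensity_ne_zero _ _)
  simp only [this, mul_zero]

/-- An invariant intensity has a constant sign. -/
lemma IsInvariantIntensity.nonpos_or_nonneg (hH : IsRenewalKernel T lmin lmax H) {d : ℝ → ℝ}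
    (hd : IsInvariantIntensity T H d) : (∀ t, d t ≤ 0) ∨ (∀ t, 0 ≤ d t) := by
  have hm := measurable_circlePart (T := T) (hd.measurable hH)
  have hmn := measurable_circlePart (T := T) (hd.neg.measurable hH)
  -- `d⁺ ≤ 𝒦d⁺` with equal finite integrals forces equality a.e.
  have hfix : circlePart T d =ᵐ[volume] convolve (waitDensity T H) (circlePart T d) :=
    ae_eq_of_ae_le_of_lintegral_le (ae_of_all _ (hd.circlePart_le hH))
      (lintegral_circlePart_ne_top hd.periodic hd.integrable)
      (measurable_convolve hH.measurable_waitDensity hm).aemeasurable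
      (hH.lintegral_convolve_waitDensity hm).le
  by_cases h0 : ∀ᵐ φ, circlePart T d φ = 0
  · left
    intro t
    have h1 := hd.circlePart_le hH (t : AddCircle T)
    rw [convolve_eq_zero hH.measurable_waitDensity hm h0, circlePart_coe hd.periodic] at h1
    simpa using h1
  · right
    -- A zero of `𝒦d⁺` would make `d⁺` null, so `d⁺ = 𝒦d⁺ > 0` almost everywhere. The negative part
    -- is then null, and the pointwise inequality for `-d` removes the exceptional set.
    have h1 : ∀ᵐ φ, circlePart T (fun t => -d t) φ = 0 := by
      filter_upwards [hfix] with φ hφ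
      have h2 : circlePart T d φ ≠ 0 := fun h => h0
        (hH.ae_eq_zero_of_convolve_eq_zero hm (hφ.symm.trans h))
      have h3 : 0 < d (phaseRep φ) := by simpa [circlePart] using h2
      simpa [circlePart] using h3.le
    intro t
    have h2 := hd.neg.circlePart_le hH (t : AddCircle T)
    rw [convolve_eq_zero hH.measurable_waitDensity hmn h1, circlePart_coe hd.neg.periodic] at h2
    simpa using h2

lemma IsInvariantIntensity.convolve_circlePart (hH : IsRenewalKernel T lmin lmax H) {d : ℝ → ℝ}
    (hd : IsInvariantIntensity T H d) (t : ℝ) :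
    convolve (waitSurvival T H) (circlePart T d) t
      = ∫⁻ u in Iic t, ENNReal.ofReal (H t u * d u) := by
  rw [hH.convolve_waitSurvival_coe (measurable_circlePart (hd.measurable hH))]
  refine setLIntegral_congr_fun measurableSet_Iic fun u hu => ?_
  simp only [circlePart_coe hd.periodic, ENNReal.ofReal_mul (hH.pos hu).le]

/-- From `K ≤ lmax * H`, `d t` is at most `lmax` times the integral assumed to vanish. -/
lemma IsInvariantIntensity.nonpos_of_integral_eq_zero (hH : IsRenewalKernel T lmin lmax H)
    {d : ℝ → ℝ} (hd : IsInvariantIntensity T H d) (h0 : ∀ t, 0 ≤ d t)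
    (hi : ∀ t, IntegrableOn (fun u => H t u * d u) (Iic t))
    (hz : ∀ t, ∫ u in Iic t, H t u * d u = 0) (t : ℝ) : d t ≤ 0 := by
  have h1 := hd.convolve_circlePart hH t
  rw [← ofReal_integral_eq_lintegral_ofReal (hi t) ((ae_restrict_mem measurableSet_Iic).mono
    fun u hu => mul_nonneg (hH.pos hu).le (h0 u)), hz t, ENNReal.ofReal_zero] at h1
  have h2 := (hd.circlePart_le hH (t : AddCircle T)).trans (hH.convolve_waitDensity_le _)
  rw [h1, mul_zero, circlePart_coe hd.periodic] at h2
  simpa using h2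

omit hT in
-- A non-integrable integrand would have Bochner integral `0`, not `1`.
lemma IsStationaryIntensity.integrableOn_survival {ρ : ℝ → ℝ} (hρ : IsStationaryIntensity T H ρ)
    (t : ℝ) : IntegrableOn (fun u => H t u * ρ u) (Iic t) := by
  by_contra h
  exact one_ne_zero ((hρ.normalized t).trans (integral_undef h))

lemma IsStationaryIntensity.integrableOn_density (hH : IsRenewalKernel T lmin lmax H) {ρ : ℝ → ℝ}
    (hρ : IsStationaryIntensity T H ρ) (t : ℝ) :
    IntegrableOn (fun u => density H t u * ρ u) (Iic t) := by
  refine ((hρ.integrableOn_survival t).const_mul lmax).mono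
    ((hH.aestronglyMeasurable_density t).mul
      (hρ.isInvariantIntensity.measurable hH).aestronglyMeasurable)
    ((ae_restrict_mem measurableSet_Iic).mono fun u hu => ?_)
  rw [norm_mul, ← mul_assoc, norm_mul, Real.norm_of_nonneg (hH.density_nonneg hu),
    Real.norm_of_nonneg (mul_nonneg hH.lmax_pos.le (hH.pos hu).le)]
  exact mul_le_mul_of_nonneg_right (hH.density_le hu) (norm_nonneg _)

/-- The sign is constant, and the normalization to `1` excludes the nonpositive case. -/
lemma IsStationaryIntensity.nonneg (hH : IsRenewalKernel T lmin lmax H) {ρ : ℝ → ℝ}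
    (hρ : IsStationaryIntensity T H ρ) (t : ℝ) : 0 ≤ ρ t := by
  refine (hρ.isInvariantIntensity.nonpos_or_nonneg hH).resolve_left (fun h => ?_) t
  have h1 := hρ.normalized 0
  have h2 : ∫ u in Iic (0 : ℝ), H 0 u * ρ u ≤ 0 :=
    setIntegral_nonpos measurableSet_Iic fun u hu =>
      mul_nonpos_of_nonneg_of_nonpos (hH.pos hu).le (h u)
  linarith

lemma IsStationaryIntensity.unique (hH : IsRenewalKernel T lmin lmax H) {ρ ρ' : ℝ → ℝ}
    (hρ : IsStationaryIntensity T H ρ) (hρ' : IsStationaryIntensity T H ρ') : ρ = ρ' := by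
  have hd : ∀ {ρ ρ' : ℝ → ℝ}, IsStationaryIntensity T H ρ → IsStationaryIntensity T H ρ' →
      IsInvariantIntensity T H (fun t => ρ t - ρ' t) := fun h h' =>
    { periodic := h.periodic.sub h'.periodic
      integrable := h.integrable.sub h'.integrable
      eq_integral := fun t => by
        simp_rw [mul_sub]
        rw [integral_sub (h.integrableOn_density hH t) (h'.integrableOn_density hH t),
          ← h.eq_integral, ← h'.eq_integral] }
  have hi : ∀ {ρ ρ' : ℝ → ℝ}, IsStationaryIntensity T H ρ → IsStationaryIntensity T H ρ' →
      ∀ t, IntegrableOn (fun u => H t u * (ρ u - ρ' u)) (Iic t) := fun h h' t => by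
    simp_rw [mul_sub]
    exact (h.integrableOn_survival t).sub (h'.integrableOn_survival t)
  have hz : ∀ {ρ ρ' : ℝ → ℝ}, IsStationaryIntensity T H ρ → IsStationaryIntensity T H ρ' →
      ∀ t, ∫ u in Iic t, H t u * (ρ u - ρ' u) = 0 := fun h h' t => by
    simp_rw [mul_sub]
    rw [integral_sub (h.integrableOn_survival t) (h'.integrableOn_survival t),
      ← h.normalized, ← h'.normalized, sub_self]
  funext t
  rcases (hd hρ hρ').nonpos_or_nonneg hH with h | h
  · have h0 : ∀ t, 0 ≤ ρ' t - ρ t := fun t => by linarith [h t]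
    have := (hd hρ' hρ).nonpos_of_integral_eq_zero hH h0 (hi hρ' hρ) (hz hρ' hρ) t
    linarith [h0 t]
  · have := (hd hρ hρ').nonpos_of_integral_eq_zero hH h (hi hρ hρ') (hz hρ hρ') t
    linarith [h t]

lemma IsRenewalKernel.exists_stationaryIntensity (hH : IsRenewalKernel T lmin lmax H) :
    ∃ ρ : ℝ → ℝ, IsStationaryIntensity T H ρ := by
  obtain ⟨f, hf, hfix, hone, hfin⟩ := hH.exists_invariant_density
  set C := convolve (waitSurvival T H) f 0 with hC
  have hconst : ∀ ψ, convolve (waitSurvival T H) f ψ = C := fun ψ =>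
    hH.convolve_waitSurvival_const hf hfix hfin ψ 0
  have hmax : ENNReal.ofReal lmax ≠ 0 := by simpa using hH.lmax_pos
  have hmin : ENNReal.ofReal lmin ≠ 0 := by simpa using hH.lmin_pos
  -- `f ≥ lmin * C` pointwise, so an infinite `C` would contradict the finite mass of `f`.
  have hCtop : C ≠ ∞ := by
    intro h
    have h1 : ∀ ψ, f ψ = ∞ := fun ψ => by
      have h2 := hH.le_convolve_waitDensity (f := f) ψ
      rw [hconst, hfix, h, ENNReal.mul_top hmin] at h2
      exact top_le_iff.mp h2
    refine hfin ?_
    simp_rw [h1]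
    rw [lintegral_const, AddCircle.measure_univ, ENNReal.top_mul]
    simpa using hT.out
  have hle : ∀ ψ, f ψ ≤ ENNReal.ofReal lmax * C := fun ψ => by
    have h2 := hH.convolve_waitDensity_le (f := f) ψ
    rwa [hconst, hfix] at h2
  -- Here the bound `1 ≤ f` is used, against `f ≤ lmax * C`.
  have hC0 : C ≠ 0 := by
    intro h
    have h1 := (hone 0).trans (hle 0)
    rw [h, mul_zero] at h1
    exact absurd h1 (by simp)
  have hftop : ∀ ψ, f ψ ≠ ∞ := fun ψ =>
    ne_top_of_le_ne_top (ENNReal.mul_ne_top ENNReal.ofReal_ne_top hCtop) (hle ψ)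
  have hC0' : C.toReal ≠ 0 := (ENNReal.toReal_pos hC0 hCtop).ne'
  have hfm : Measurable fun u : ℝ => (f (u : AddCircle T)).toReal :=
    (hf.comp AddCircle.measurable_mk').ennreal_toReal
  have hint : ∀ (t : ℝ) (κ : ℝ → ℝ), AEStronglyMeasurable κ (volume.restrict (Iic t)) →
      (∀ u ≤ t, 0 ≤ κ u) → ∫ u in Iic t, κ u * ((f (u : AddCircle T)).toReal / C.toReal)
        = (∫⁻ u in Iic t, ENNReal.ofReal (κ u) * f (u : AddCircle T)).toReal / C.toReal := by
    intro t κ hκ hκ0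
    simp_rw [← mul_div_assoc]
    rw [integral_div, integral_eq_lintegral_of_nonneg_ae
      ((ae_restrict_mem measurableSet_Iic).mono fun u hu => mul_nonneg (hκ0 u hu)
        ENNReal.toReal_nonneg) (hκ.mul hfm.aestronglyMeasurable)]
    congr 2
    refine setLIntegral_congr_fun measurableSet_Iic fun u hu => ?_
    simp only [ENNReal.ofReal_mul (hκ0 u hu), ENNReal.ofReal_toReal (hftop _)]
  refine ⟨fun t => (f (t : AddCircle T)).toReal / C.toReal, ?_, ?_, fun t => ?_, fun t => ?_⟩
  · intro t
    simp
  · refine Integrable.div_const ?_ _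
    refine integrable_toReal_of_lintegral_ne_top (hf.comp AddCircle.measurable_mk').aemeasurable ?_
    have := AddCircle.lintegral_preimage T 0 f
    rw [zero_add] at this
    exact ne_of_eq_of_ne this hfin
  · rw [hint t _ (hH.aestronglyMeasurable_density t) fun u hu => hH.density_nonneg hu,
      ← hH.convolve_waitDensity_coe hf, hfix]
  · rw [hint t _ (hH.aestronglyMeasurable_survival t) fun u hu => (hH.pos hu).le,
      ← hH.convolve_waitSurvival_coe hf, hconst, div_self hC0']

end Intensity

/-! ### Translation and reflection of integrals over the half-line. -/

section HalfLine

instance : NullSingletonClass volumeNN := by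
  refine ⟨fun x => ?_⟩
  rw [volumeNN, Measure.map_apply measurable_real_toNNReal (measurableSet_singleton x),
    Measure.restrict_apply (measurable_real_toNNReal (measurableSet_singleton x))]
  refine measure_mono_null (t := {(x : ℝ)}) (fun y hy => ?_) (measure_singleton _)
  have h1 : y.toNNReal = x := hy.1
  rw [mem_singleton_iff, ← h1, Real.coe_toNNReal _ hy.2]

lemma setLIntegral_Iic_volumeNN {h : ℝ≥0 → ℝ≥0∞} (hh : Measurable h) (x : ℝ≥0) :
    ∫⁻ u in Iic x, h u ∂volumeNN = ∫⁻ s in Ioc (0 : ℝ) x, h s.toNNReal := by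
  rw [← lintegral_indicator measurableSet_Iic, lintegral_volumeNN (hh.indicator measurableSet_Iic),
    setLIntegral_congr Ioi_ae_eq_Ici.symm, ← lintegral_indicator measurableSet_Ioi,
    ← lintegral_indicator measurableSet_Ioc]
  refine lintegral_congr fun s => ?_
  by_cases h0 : 0 < s
  · by_cases h1 : s ≤ x
    · rw [indicator_of_mem (mem_Ioi.mpr h0), indicator_of_mem (show s ∈ Ioc 0 (x : ℝ) from ⟨h0, h1⟩),
        indicator_of_mem (show s.toNNReal ∈ Iic x from Real.toNNReal_le_iff_le_coe.mpr h1)]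
    · rw [indicator_of_mem (mem_Ioi.mpr h0),
        indicator_of_notMem (show s ∉ Ioc 0 (x : ℝ) from fun h => h1 h.2),
        indicator_of_notMem (show s.toNNReal ∉ Iic x from
          fun h => h1 (Real.toNNReal_le_iff_le_coe.mp h))]
  · rw [indicator_of_notMem (show s ∉ Ioi 0 from h0),
      indicator_of_notMem (show s ∉ Ioc 0 (x : ℝ) from fun h => h0 h.1)]

lemma lintegral_volumeNN_eq_add {h : ℝ≥0 → ℝ≥0∞} (hh : Measurable h) (t : ℝ≥0) :
    ∫⁻ u, h u ∂volumeNN = (∫⁻ u in Iic t, h u ∂volumeNN) + ∫⁻ u, h (t + u) ∂volumeNN := by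
  have hm : Measurable fun u => h (t + u) := hh.comp (measurable_const_add t)
  rw [setLIntegral_Iic_volumeNN hh, lintegral_volumeNN hh, lintegral_volumeNN hm,
    setLIntegral_congr Ioi_ae_eq_Ici.symm, setLIntegral_congr (Ioi_ae_eq_Ici (a := (0 : ℝ))).symm]
  have hs : ∫⁻ s in Ioi (0 : ℝ), h s.toNNReal = (∫⁻ s in Ioc (0 : ℝ) t, h s.toNNReal)
      + ∫⁻ s in Ioi (t : ℝ), h s.toNNReal := by
    rw [← Ioc_union_Ioi_eq_Ioi t.coe_nonneg,
      lintegral_union measurableSet_Ioi (Ioc_disjoint_Ioi le_rfl)]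
  rw [hs]
  congr 1
  rw [← lintegral_indicator measurableSet_Ioi, ← lintegral_indicator measurableSet_Ioi,
    ← lintegral_add_left_eq_self ((Ioi (t : ℝ)).indicator fun s => h s.toNNReal) (t : ℝ)]
  refine lintegral_congr fun s => ?_
  by_cases hs : 0 < s
  · rw [indicator_of_mem (show (t : ℝ) + s ∈ Ioi (t : ℝ) from by simpa using hs),
      indicator_of_mem (mem_Ioi.mpr hs), Real.toNNReal_add t.coe_nonneg hs.le, Real.toNNReal_coe]
  · rw [indicator_of_notMem (show (t : ℝ) + s ∉ Ioi (t : ℝ) from by simpa using hs),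
      indicator_of_notMem (show s ∉ Ioi 0 from hs)]

lemma setLIntegral_Iic_add {h : ℝ≥0 → ℝ≥0∞} (hh : Measurable h) (t x : ℝ≥0) :
    ∫⁻ u in Iic (t + x), h u ∂volumeNN
      = (∫⁻ u in Iic t, h u ∂volumeNN) + ∫⁻ u in Iic x, h (t + u) ∂volumeNN := by
  have h1 := lintegral_volumeNN_eq_add (hh.indicator (measurableSet_Iic (a := t + x))) t
  rw [lintegral_indicator measurableSet_Iic] at h1
  rw [h1, ← lintegral_indicator measurableSet_Iic, ← lintegral_indicator measurableSet_Iic,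
    ← lintegral_indicator measurableSet_Iic]
  congr 1
  · refine lintegral_congr fun u => ?_
    by_cases hu : u ≤ t
    · rw [indicator_of_mem (mem_Iic.mpr hu), indicator_of_mem (mem_Iic.mpr hu),
        indicator_of_mem (mem_Iic.mpr (hu.trans le_self_add))]
    · rw [indicator_of_notMem (show u ∉ Iic t from hu), indicator_of_notMem (show u ∉ Iic t from hu)]
  · refine lintegral_congr fun u => ?_
    simp [indicator_apply]

lemma setLIntegral_Iic_reflect {h : ℝ≥0 → ℝ≥0∞} (hh : Measurable h) (x : ℝ≥0) :
    ∫⁻ u in Iic x, h (x - u) ∂volumeNN = ∫⁻ u in Iic x, h u ∂volumeNN := by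
  have hm : Measurable fun u => h (x - u) := hh.comp (measurable_const.sub measurable_id)
  rw [setLIntegral_Iic_volumeNN hm, setLIntegral_Iic_volumeNN hh,
    setLIntegral_congr (Ioo_ae_eq_Ioc (a := (0 : ℝ)) (b := x)).symm,
    setLIntegral_congr (Ioo_ae_eq_Ioc (a := (0 : ℝ)) (b := x)).symm,
    ← lintegral_indicator measurableSet_Ioo, ← lintegral_indicator measurableSet_Ioo,
    ← lintegral_sub_left_eq_self _ (x : ℝ)]
  refine lintegral_congr fun s => ?_
  by_cases hs : s ∈ Ioo 0 (x : ℝ)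
  · have hs' : (x : ℝ) - s ∈ Ioo 0 (x : ℝ) := ⟨by linarith [hs.2], by linarith [hs.1]⟩
    rw [indicator_of_mem hs, indicator_of_mem hs']
    have h1 : ((x : ℝ) - s).toNNReal = x - s.toNNReal := by
      rw [NNReal.sub_def, Real.coe_toNNReal _ hs.1.le]
    rw [h1, tsub_tsub_cancel_of_le (Real.toNNReal_le_iff_le_coe.mpr hs.2.le)]
  · have hs' : (x : ℝ) - s ∉ Ioo 0 (x : ℝ) := fun h => hs ⟨by linarith [h.2], by linarith [h.1]⟩
    rw [indicator_of_notMem hs, indicator_of_notMem hs']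

end HalfLine

/-! ### Deterministic path identities: flow between jumps and restart at a jump. -/

section Pathwise

variable {T : ℝ}

lemma jumpTime_cons_zero (z : State T) (ω : ℕ → State T) : jumpTime (cons z ω) 0 = z.1 := by
  simp [jumpTime]

lemma jumpTime_cons_succ (z : State T) (ω : ℕ → State T) (n : ℕ) :
    jumpTime (cons z ω) (n + 1) = z.1 + jumpTime ω n := by
  rw [jumpTime, Finset.sum_range_succ', add_comm]
  rfl

/-- The path started from `(x, φ)` flows through `(u, φ)` at time `x - u`, and all later jumps are
delayed by that amount. -/
lemma pdmpState_cons_add {u x : ℝ≥0} (h : u ≤ x) (φ : AddCircle T) (ω : ℕ → State T) (t : ℝ≥0) :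
    pdmpState t (cons (u, φ) ω) = pdmpState (t + (x - u)) (cons (x, φ) ω) := by
  have h1 : ∀ n, jumpTime (cons (x, φ) ω) n = jumpTime (cons (u, φ) ω) n + (x - u) := by
    intro n
    cases n with
    | zero => rw [jumpTime_cons_zero, jumpTime_cons_zero]; exact (add_tsub_cancel_of_le h).symm
    | succ n =>
      rw [jumpTime_cons_succ, jumpTime_cons_succ, add_right_comm, add_tsub_cancel_of_le h]
  have h2 : jumpCount (t + (x - u)) (cons (x, φ) ω) = jumpCount t (cons (u, φ) ω) := by
    unfold jumpCount
    congr 1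
    ext n
    simp only [mem_ofPred_eq, h1, add_lt_add_iff_right]
  have h3 : ∀ n, (cons (x, φ) ω n).2 = (cons (u, φ) ω n).2 := by
    intro n
    cases n <;> rfl
  unfold pdmpState
  rw [h2, h1, h3, add_tsub_add_eq_tsub_right]

lemma pdmpState_cons_of_lt {t : ℝ≥0} {z : State T} (h : t < z.1) (ω : ℕ → State T) :
    pdmpState t (cons z ω) = (z.1 - t, z.2) := by
  have h1 : jumpCount t (cons z ω) = 0 :=
    Nat.sInf_eq_zero.mpr (Or.inl (by simpa [jumpTime_cons_zero] using h))
  rw [pdmpState, h1, jumpTime_cons_zero, cons_zero]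

lemma pdmpState_of_lt {t : ℝ≥0} {ω : ℕ → State T} (h : t < (ω 0).1) :
    pdmpState t ω = ((ω 0).1 - t, (ω 0).2) := by
  have h1 := pdmpState_cons_of_lt h (fun n => ω (n + 1))
  rwa [cons_shift] at h1

/-- At the first jump the path restarts from the remaining sequence. Without `h` both jump counts
take the default value `0` of `sInf ∅`, and the shift by one fails. -/
lemma pdmpState_add_cons (z : State T) {ω : ℕ → State T} {t : ℝ≥0} (h : ∃ n, t < jumpTime ω n) :
    pdmpState (z.1 + t) (cons z ω) = pdmpState t ω := by
  have h1 : jumpCount (z.1 + t) (cons z ω) = jumpCount t ω + 1 := by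
    have hmem : t < jumpTime ω (jumpCount t ω) := Nat.sInf_mem (s := {n | t < jumpTime ω n}) h
    have hmem' : z.1 + t < jumpTime (cons z ω) (jumpCount t ω + 1) := by
      rw [jumpTime_cons_succ]; exact add_lt_add_right hmem _
    refine le_antisymm (Nat.sInf_le hmem') ?_
    have hm : z.1 + t < jumpTime (cons z ω) (jumpCount (z.1 + t) (cons z ω)) :=
      Nat.sInf_mem (s := {n | z.1 + t < jumpTime (cons z ω) n}) ⟨_, hmem'⟩
    generalize jumpCount (z.1 + t) (cons z ω) = k at hm
    cases k with
    | zero =>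
      rw [jumpTime_cons_zero] at hm
      exact absurd hm (not_lt.mpr le_self_add)
    | succ k =>
      rw [jumpTime_cons_succ] at hm
      exact Nat.succ_le_succ (Nat.sInf_le (lt_of_add_lt_add_left hm))
  rw [pdmpState, h1, jumpTime_cons_succ, cons_succ, add_tsub_add_eq_tsub_left, pdmpState]

/-- Joint measurability in time and path, for the applications of Tonelli in the time variable. -/
lemma measurable_pdmpState_uncurry :
    Measurable fun p : ℝ≥0 × (ℕ → State T) => pdmpState p.1 p.2 := by
  have hm : ∀ n, MeasurableSet {p : ℝ≥0 × (ℕ → State T) | p.1 < jumpTime p.2 n} := fun n =>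
    measurableSet_lt measurable_fst ((measurable_jumpTime n).comp measurable_snd)
  have hc : Measurable fun p : ℝ≥0 × (ℕ → State T) => jumpCount p.1 p.2 := by
    refine measurable_of_Ioi fun n => ?_
    have : (fun p : ℝ≥0 × (ℕ → State T) => jumpCount p.1 p.2) ⁻¹' Ioi n
        = (⋂ k ∈ Finset.range (n + 1), {p : ℝ≥0 × (ℕ → State T) | p.1 < jumpTime p.2 k}ᶜ)
          ∩ ⋃ k, {p : ℝ≥0 × (ℕ → State T) | p.1 < jumpTime p.2 k} := by
      ext p
      simp only [mem_preimage, mem_Ioi, mem_ofPred_eq, mem_inter_iff, mem_iInter, mem_iUnion,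
        mem_compl_iff, Finset.mem_range]
      constructor
      · intro h
        refine ⟨fun k hk hk' => ?_, ?_⟩
        · have : jumpCount p.1 p.2 ≤ k := Nat.sInf_le hk'
          omega
        · by_contra hne
          have he : {n | p.1 < jumpTime p.2 n} = ∅ := by
            ext k
            simpa using not_exists.mp hne k
          rw [jumpCount, he, Nat.sInf_empty] at h
          omega
      · rintro ⟨h1, h2⟩
        by_contra hlt
        exact h1 (jumpCount p.1 p.2) (by omega)
          (Nat.sInf_mem (s := {n | p.1 < jumpTime p.2 n}) h2)
    rw [this]
    exact (Finset.measurableSet_biInter _ fun k _ => (hm k).compl).inter (MeasurableSet.iUnion hm)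
  have h1 : Measurable fun q : ℕ × (ℝ≥0 × (ℕ → State T)) => jumpTime q.2.2 q.1 - q.2.1 :=
    measurable_from_prod_countable_right fun n =>
      ((measurable_jumpTime n).comp measurable_snd).sub measurable_fst
  have h2 : Measurable fun q : ℕ × (ℝ≥0 × (ℕ → State T)) => (q.2.2 q.1).2 :=
    measurable_from_prod_countable_right fun n =>
      measurable_snd.comp ((measurable_pi_apply n).comp measurable_snd)
  have h3 : Measurable fun p : ℝ≥0 × (ℕ → State T) => (jumpCount p.1 p.2, p) :=
    hc.prodMk measurable_id
  exact (h1.comp h3).prodMk (h2.comp h3)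

end Pathwise

/-! ### Non-accumulation of jumps, by a Laplace transform bound. -/

section NonExplosion

variable {T lmin lmax : ℝ} {H : ℝ → ℝ → ℝ} [hT : Fact (0 < T)]

/-- The waiting density at `x` is at most `lmax * exp(-lmin * x)`. The transform is taken at rate
`lmax`, which makes the resulting bound `lmax / (lmin + lmax)` less than `1`, uniformly in the
phase. -/
lemma IsRenewalKernel.lintegral_waitDensity_exp_le (hH : IsRenewalKernel T lmin lmax H)
    (φ : AddCircle T) :
    ∫⁻ x : ℝ≥0, waitDensity T H φ x * ENNReal.ofReal (Real.exp (-(lmax * x))) ∂volumeNN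
      ≤ ENNReal.ofReal (lmax / (lmin + lmax)) := by
  have h0 := hH.lmin_pos
  have h1 := hH.lmax_pos
  have hm : Measurable fun x : ℝ≥0 =>
      ENNReal.ofReal (lmax * Real.exp (-(lmin + lmax) * (x : ℝ))) := by fun_prop
  have hb : ∀ x : ℝ≥0, waitDensity T H φ x * ENNReal.ofReal (Real.exp (-(lmax * x)))
      ≤ ENNReal.ofReal (lmax * Real.exp (-(lmin + lmax) * (x : ℝ))) := fun x => by
    rw [waitDensity, ← ENNReal.ofReal_mul' (Real.exp_pos _).le]
    refine ENNReal.ofReal_le_ofReal ?_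
    have h2 := hH.density_le (t := x + phaseRep φ) (u := phaseRep φ) (by simp)
    have h3 := hH.le_exp (x := x) (u := phaseRep φ) x.2
    rw [add_comm] at h3
    have h4 : Real.exp (-(lmin + lmax) * (x : ℝ))
        = Real.exp (-(lmin * x)) * Real.exp (-(lmax * x)) := by
      rw [← Real.exp_add]; congr 1; ring
    rw [h4, ← mul_assoc]
    exact mul_le_mul_of_nonneg_right (h2.trans (mul_le_mul_of_nonneg_left h3 h1.le))
      (Real.exp_pos _).le
  refine (lintegral_mono hb).trans ?_
  rw [lintegral_volumeNN hm, setLIntegral_congr Ioi_ae_eq_Ici.symm]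
  have hint := integrableOn_exp_mul_Ioi (a := -(lmin + lmax)) (by linarith) 0
  have e : ∫⁻ x in Ioi (0 : ℝ), ENNReal.ofReal (lmax * Real.exp (-(lmin + lmax) * (x.toNNReal : ℝ)))
      = ∫⁻ x in Ioi (0 : ℝ), ENNReal.ofReal (lmax * Real.exp (-(lmin + lmax) * x)) :=
    setLIntegral_congr_fun measurableSet_Ioi fun x hx => by
      simp only [Real.coe_toNNReal x (mem_Ioi.mp hx).le]
  rw [e, ← ofReal_integral_eq_lintegral_ofReal (hint.const_mul lmax)
    (ae_of_all _ fun x => by positivity), integral_const_mul,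
    integral_exp_mul_Ioi (a := -(lmin + lmax)) (by linarith)]
  refine ENNReal.ofReal_le_ofReal (le_of_eq ?_)
  rw [mul_zero, Real.exp_zero, div_neg, neg_div, neg_neg, mul_one_div]

omit hT in
lemma measurable_exp_jumpTime (n : ℕ) : Measurable fun ω : ℕ → State T =>
    ENNReal.ofReal (Real.exp (-(lmax * (jumpTime ω n : ℝ)))) :=
  ((Real.measurable_exp.comp ((measurable_coe_nnreal_real.comp
    (measurable_jumpTime n)).const_mul lmax).neg)).ennreal_ofReal

lemma IsRenewalKernel.lintegral_exp_jumpTime_le (hH : IsRenewalKernel T lmin lmax H) (n : ℕ) :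
    ∀ φ, ∫⁻ ω, ENNReal.ofReal (Real.exp (-(lmax * (jumpTime ω n : ℝ)))) ∂(pathKernel hH φ)
      ≤ ENNReal.ofReal (lmax / (lmin + lmax)) ^ (n + 1) := by
  have hme : Measurable fun z : State T =>
      ENNReal.ofReal (Real.exp (-(lmax * (z.1 : ℝ)))) := by fun_prop
  induction n with
  | zero =>
    intro φ
    rw [lintegral_pathKernel hH φ (measurable_exp_jumpTime 0)]
    simp_rw [jumpTime_cons_zero, lintegral_const, measure_univ, mul_one]
    rw [hH.lintegral_jumpKernel φ hme, zero_add, pow_one]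
    exact hH.lintegral_waitDensity_exp_le φ
  | succ n ih =>
    intro φ
    rw [lintegral_pathKernel hH φ (measurable_exp_jumpTime (n + 1))]
    have h1 : ∀ z : State T, ∫⁻ ω, ENNReal.ofReal
        (Real.exp (-(lmax * (jumpTime (cons z ω) (n + 1) : ℝ)))) ∂(pathKernel hH z.2)
        ≤ ENNReal.ofReal (Real.exp (-(lmax * (z.1 : ℝ))))
          * ENNReal.ofReal (lmax / (lmin + lmax)) ^ (n + 1) := fun z => by
      refine le_trans (le_of_eq ?_) (mul_le_mul_right (ih z.2) _)
      rw [← lintegral_const_mul _ (measurable_exp_jumpTime n)]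
      refine lintegral_congr fun ω => ?_
      rw [jumpTime_cons_succ, ← ENNReal.ofReal_mul (Real.exp_pos _).le, ← Real.exp_add]
      congr 2
      push_cast
      ring
    refine (lintegral_mono h1).trans ?_
    rw [lintegral_mul_const _ hme, hH.lintegral_jumpKernel φ hme, pow_succ' _ (n + 1)]
    exact mul_le_mul_left (hH.lintegral_waitDensity_exp_le φ) _

/-- The jump times do not accumulate. -/
lemma IsRenewalKernel.ae_exists_lt_jumpTime (hH : IsRenewalKernel T lmin lmax H) (φ : AddCircle T)
    (t : ℝ≥0) : ∀ᵐ ω ∂(pathKernel hH φ), ∃ n, t < jumpTime ω n := by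
  have h0 := hH.lmin_pos
  have h1 := hH.lmax_pos
  set B : Set (ℕ → State T) := {ω | ¬ ∃ n, t < jumpTime ω n} with hB
  set c := ENNReal.ofReal (Real.exp (-(lmax * (t : ℝ)))) with hc
  have hc0 : c ≠ 0 := by simpa [hc] using Real.exp_pos _
  have hle : ∀ n : ℕ, c * pathKernel hH φ B ≤ ENNReal.ofReal (lmax / (lmin + lmax)) ^ (n + 1) := by
    intro n
    refine le_trans ?_ (hH.lintegral_exp_jumpTime_le n φ)
    -- Markov's inequality: on `B` every jump time is at most `t`, so the exponential is at least
    -- `c` for every `n`.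
    refine le_trans (mul_le_mul_right (measure_mono fun ω hω => ?_) _)
      (mul_meas_ge_le_lintegral (measurable_exp_jumpTime n) c)
    have h2 : jumpTime ω n ≤ t := not_lt.mp (not_exists.mp hω n)
    refine ENNReal.ofReal_le_ofReal (Real.exp_le_exp.mpr (neg_le_neg ?_))
    exact mul_le_mul_of_nonneg_left (by exact_mod_cast h2) h1.le
  have hlim : Tendsto (fun n : ℕ => ENNReal.ofReal (lmax / (lmin + lmax)) ^ (n + 1)) atTop (𝓝 0) := by
    refine (tendsto_add_atTop_iff_nat 1).mpr (ENNReal.tendsto_pow_atTop_nhds_zero_of_lt_one ?_)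
    rw [← ENNReal.ofReal_one]
    refine (ENNReal.ofReal_lt_ofReal_iff one_pos).mpr ?_
    rw [div_lt_one (by linarith)]
    linarith
  have h2 : c * pathKernel hH φ B ≤ 0 := ge_of_tendsto' hlim hle
  exact (mul_eq_zero.mp (le_antisymm h2 zero_le)).resolve_left hc0

end NonExplosion

/-! ### Palm's formula and the total mass of `μ̃_∞`. -/

section Palm

variable {T lmin lmax : ℝ} {H : ℝ → ℝ → ℝ} {ρ : ℝ → ℝ} [hT : Fact (0 < T)]

/-- The integral of `g` over the time spent in the course of a waiting time, as a function of the
state at the beginning of the waiting time. -/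
def occupation (g : State T → ℝ≥0∞) (z : State T) : ℝ≥0∞ :=
  ∫⁻ u in Iic z.1, g (u, z.2) ∂volumeNN

omit hT in
lemma measurable_setLIntegral_Iic {α : Type*} [MeasurableSpace α] {b : α → ℝ≥0}
    (hb : Measurable b) {g : α × ℝ≥0 → ℝ≥0∞} (hg : Measurable g) :
    Measurable fun a => ∫⁻ u in Iic (b a), g (a, u) ∂volumeNN := by
  have hs : MeasurableSet {p : α × ℝ≥0 | p.2 ≤ b p.1} :=
    measurableSet_le measurable_snd (hb.comp measurable_fst)
  have h := (hg.indicator hs).lintegral_prod_right' (ν := volumeNN)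
  convert h using 2 with a
  rw [← lintegral_indicator measurableSet_Iic]
  rfl

omit hT in
lemma measurable_occupation {g : State T → ℝ≥0∞} (hg : Measurable g) :
    Measurable (occupation g) :=
  measurable_setLIntegral_Iic (b := fun z : State T => z.1) measurable_fst
    (g := fun p : State T × ℝ≥0 => g (p.2, p.1.2))
    (hg.comp (measurable_snd.prodMk (measurable_snd.comp measurable_fst)))

lemma IsStationaryIntensity.measurable_circlePart (hH : IsRenewalKernel T lmin lmax H)
    (hρ : IsStationaryIntensity T H ρ) : Measurable (circlePart T ρ) :=
  PeriodicRenewal.measurable_circlePart (hρ.isInvariantIntensity.measurable hH)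

lemma IsStationaryIntensity.convolve_waitDensity (hH : IsRenewalKernel T lmin lmax H)
    (hρ : IsStationaryIntensity T H ρ) (ψ : AddCircle T) :
    convolve (waitDensity T H) (circlePart T ρ) ψ = circlePart T ρ ψ := by
  obtain ⟨t, rfl⟩ := QuotientAddGroup.mk_surjective ψ
  refine (hH.convolve_waitDensity_coe (hρ.measurable_circlePart hH) t).trans ?_
  refine Eq.trans ?_ (circlePart_coe hρ.periodic t).symm
  rw [hρ.eq_integral t, ofReal_integral_eq_lintegral_ofReal (hρ.integrableOn_density hH t)
    ((ae_restrict_mem measurableSet_Iic).mono fun u hu =>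
      mul_nonneg (hH.density_nonneg hu) (hρ.nonneg hH u))]
  refine setLIntegral_congr_fun measurableSet_Iic fun u hu => ?_
  simp only [circlePart_coe hρ.periodic, ENNReal.ofReal_mul (hH.density_nonneg hu)]

lemma IsStationaryIntensity.convolve_waitSurvival (hH : IsRenewalKernel T lmin lmax H)
    (hρ : IsStationaryIntensity T H ρ) (ψ : AddCircle T) :
    convolve (waitSurvival T H) (circlePart T ρ) ψ = 1 := by
  obtain ⟨t, rfl⟩ := QuotientAddGroup.mk_surjective ψ
  refine (hρ.isInvariantIntensity.convolve_circlePart hH t).trans ?_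
  rw [← ofReal_integral_eq_lintegral_ofReal (hρ.integrableOn_survival t)
    ((ae_restrict_mem measurableSet_Iic).mono fun u hu =>
      mul_nonneg (hH.pos hu).le (hρ.nonneg hH u)), ← hρ.normalized t, ENNReal.ofReal_one]

/-- Change of variables from the phase `φ` of an event to the phase `ψ = φ + x` of the next one. -/
lemma IsRenewalKernel.lintegral_mul_jumpKernel (hH : IsRenewalKernel T lmin lmax H)
    {r : AddCircle T → ℝ≥0∞} (hr : Measurable r) {h : State T → ℝ≥0∞} (hh : Measurable h) :
    ∫⁻ φ, r φ * ∫⁻ z, h z ∂(jumpKernel T H φ)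
      = ∫⁻ ψ, ∫⁻ x : ℝ≥0, waitDensity T H (ψ - ((x : ℝ) : AddCircle T)) x
          * r (ψ - ((x : ℝ) : AddCircle T)) * h (x, ψ) ∂volumeNN := by
  have hj : Measurable fun p : AddCircle T × ℝ≥0 => h (p.2, p.1 + ((p.2 : ℝ) : AddCircle T)) :=
    hh.comp measurable_jump
  have hG : Measurable (Function.uncurry fun (φ : AddCircle T) (x : ℝ≥0) =>
      waitDensity T H φ x * r φ * h (x, φ + ((x : ℝ) : AddCircle T))) :=
    (measurable_mul_fst hH.measurable_waitDensity hr).mul hj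
  have h1 := lintegral_circle_shift hG
  simp only [sub_add_cancel] at h1
  rw [h1]
  refine lintegral_congr fun φ => ?_
  have hm : Measurable fun x : ℝ≥0 => waitDensity T H φ x
      * h (x, φ + ((x : ℝ) : AddCircle T)) :=
    hH.measurable_waitDensity.of_uncurry_left.mul (hj.comp (measurable_prodMk_left (x := φ)))
  rw [hH.lintegral_jumpKernel φ hh, ← lintegral_const_mul _ hm]
  exact lintegral_congr fun x => by ring

/-- The density `ρ` of the phases is invariant under the jumps. -/
lemma IsStationaryIntensity.lintegral_jumpKernel_snd (hH : IsRenewalKernel T lmin lmax H)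
    (hρ : IsStationaryIntensity T H ρ) {h : AddCircle T → ℝ≥0∞} (hh : Measurable h) :
    ∫⁻ φ, circlePart T ρ φ * ∫⁻ z, h z.2 ∂(jumpKernel T H φ)
      = ∫⁻ φ, circlePart T ρ φ * h φ := by
  have hr := hρ.measurable_circlePart hH
  have hh' : Measurable fun z : State T => h z.2 := hh.comp measurable_snd
  rw [hH.lintegral_mul_jumpKernel hr hh']
  refine lintegral_congr fun ψ => ?_
  dsimp only
  rw [lintegral_mul_const _ (measurable_convolve_integrand hH.measurable_waitDensity hr ψ)]
  congr 1
  exact hρ.convolve_waitDensity hH ψ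

/-- The density `μ̃_∞`, up to the factor `1 / T`. -/
def palmDensity (T : ℝ) [Fact (0 < T)] (H : ℝ → ℝ → ℝ) (r : AddCircle T → ℝ≥0∞)
    (p : State T) : ℝ≥0∞ :=
  ∫⁻ y : ℝ≥0, (Ici p.1).indicator (fun y => waitDensity T H (p.2 - ((y : ℝ) : AddCircle T)) y
    * r (p.2 - ((y : ℝ) : AddCircle T))) y ∂volumeNN

omit hT in
lemma measurable_convolve_integrand_prod {W : AddCircle T → ℝ≥0 → ℝ≥0∞}
    (hW : Measurable (Function.uncurry W)) {f : AddCircle T → ℝ≥0∞} (hf : Measurable f) :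
    Measurable fun p : AddCircle T × ℝ≥0 =>
      W (p.1 - ((p.2 : ℝ) : AddCircle T)) p.2 * f (p.1 - ((p.2 : ℝ) : AddCircle T)) :=
  (measurable_mul_fst hW hf).comp measurable_sub_coe

lemma IsRenewalKernel.measurable_palmIntegrand (hH : IsRenewalKernel T lmin lmax H)
    {r : AddCircle T → ℝ≥0∞} (hr : Measurable r) : Measurable fun q : State T × ℝ≥0 =>
      (Ici q.1.1).indicator (fun y => waitDensity T H (q.1.2 - ((y : ℝ) : AddCircle T)) y
        * r (q.1.2 - ((y : ℝ) : AddCircle T))) q.2 := by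
  have h0 := measurable_convolve_integrand_prod hH.measurable_waitDensity hr
  have hc : Measurable fun q : State T × ℝ≥0 => (q.1.2, q.2) :=
    (measurable_snd.comp measurable_fst).prodMk measurable_snd
  have h1 := h0.comp hc
  exact h1.indicator (s := {q : State T × ℝ≥0 | q.1.1 ≤ q.2})
    (measurableSet_le (measurable_fst.comp measurable_fst) measurable_snd)

lemma IsRenewalKernel.measurable_palmDensity (hH : IsRenewalKernel T lmin lmax H)
    {r : AddCircle T → ℝ≥0∞} (hr : Measurable r) : Measurable (palmDensity T H r) :=
  (hH.measurable_palmIntegrand hr).lintegral_prod_right' (ν := volumeNN)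

/-- Substitution `v = φ - y`: the range `v ≤ φ - u` becomes waiting times `y ≥ u`. -/
lemma IsStationaryIntensity.ofReal_muDensity (hH : IsRenewalKernel T lmin lmax H)
    (hρ : IsStationaryIntensity T H ρ) (p : State T) :
    ENNReal.ofReal (muDensity T H ρ p.1 (phaseRep p.2))
      = ENNReal.ofReal (1 / T) * palmDensity T H (circlePart T ρ) p := by
  obtain ⟨x, ψ⟩ := p
  have hT0 := hT.out
  set t := phaseRep ψ with ht
  have hψ : ψ = (t : AddCircle T) := (coe_phaseRep ψ).symm
  have hxt : t - x ≤ t := by simp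
  rw [muDensity, ENNReal.ofReal_mul (by positivity), ofReal_integral_eq_lintegral_ofReal
    ((hρ.integrableOn_density hH t).mono_set (Iic_subset_Iic.mpr hxt))
    ((ae_restrict_mem measurableSet_Iic).mono fun u hu =>
      mul_nonneg (hH.density_nonneg ((mem_Iic.mp hu).trans hxt)) (hρ.nonneg hH u))]
  congr 1
  have hW : Measurable (Function.uncurry fun (φ : AddCircle T) (y : ℝ≥0) =>
      (Ici x).indicator (waitDensity T H φ) y) :=
    hH.measurable_waitDensity.indicator (s := {q : AddCircle T × ℝ≥0 | x ≤ q.2})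
      (measurableSet_le measurable_const measurable_snd)
  have h1 := convolve_coe hW (hρ.measurable_circlePart hH) t
  rw [← hψ] at h1
  have h2 : palmDensity T H (circlePart T ρ) (x, ψ)
      = convolve (fun φ y => (Ici x).indicator (waitDensity T H φ) y) (circlePart T ρ) ψ :=
    lintegral_congr fun y => by by_cases hy : x ≤ y <;> simp [hy]
  rw [h2, h1, ← lintegral_indicator measurableSet_Iic, ← lintegral_indicator measurableSet_Iic]
  refine lintegral_congr fun u => ?_
  by_cases hu : u ≤ t - x
  · have hut : u ≤ t := hu.trans hxt
    have h3 : x ≤ (t - u).toNNReal := by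
      rw [Real.le_toNNReal_iff_coe_le (by linarith)]; linarith
    rw [indicator_of_mem (mem_Iic.mpr hu), indicator_of_mem (mem_Iic.mpr hut),
      indicator_of_mem (mem_Ici.mpr h3), hH.waitDensity_coe,
      Real.coe_toNNReal _ (sub_nonneg.mpr hut), add_sub_cancel, circlePart_coe hρ.periodic,
      ENNReal.ofReal_mul (hH.density_nonneg hut)]
  · rw [indicator_of_notMem (show u ∉ Iic (t - x) from hu)]
    by_cases hut : u ≤ t
    · have h3 : ¬ x ≤ (t - u).toNNReal := by
        rw [Real.le_toNNReal_iff_coe_le (by linarith)]; intro h; exact hu (by linarith)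
      rw [indicator_of_mem (mem_Iic.mpr hut), indicator_of_notMem (show _ ∉ Ici x from h3),
        zero_mul]
    · rw [indicator_of_notMem (show u ∉ Iic t from hut)]

/-- Palm's formula for `μ̃_∞`. -/
lemma IsStationaryIntensity.lintegral_muInfty (hH : IsRenewalKernel T lmin lmax H)
    (hρ : IsStationaryIntensity T H ρ) {g : State T → ℝ≥0∞} (hg : Measurable g) :
    ∫⁻ p, g p ∂(muInfty T H ρ) = ENNReal.ofReal (1 / T)
      * ∫⁻ φ, circlePart T ρ φ * ∫⁻ z, occupation g z ∂(jumpKernel T H φ) := by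
  have hr := hρ.measurable_circlePart hH
  have hq := hH.measurable_palmDensity hr
  rw [muInfty]
  simp_rw [hρ.ofReal_muDensity hH]
  rw [lintegral_withDensity_eq_lintegral_mul _ (hq.const_mul _) hg]
  simp only [Pi.mul_apply, mul_assoc]
  have hqg : Measurable fun p => palmDensity T H (circlePart T ρ) p * g p := hq.mul hg
  rw [lintegral_const_mul _ hqg, lintegral_prod_symm' _ hqg,
    hH.lintegral_mul_jumpKernel hr (measurable_occupation hg)]
  congr 1
  refine lintegral_congr fun ψ => ?_
  have hm := (hH.measurable_palmIntegrand hr).comp (f := fun q : ℝ≥0 × ℝ≥0 => ((q.1, ψ), q.2))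
    (by fun_prop)
  have hgψ : Measurable fun x : ℝ≥0 => g (x, ψ) := hg.comp measurable_prodMk_right
  calc ∫⁻ x, palmDensity T H (circlePart T ρ) (x, ψ) * g (x, ψ) ∂volumeNN
      = ∫⁻ x, ∫⁻ y : ℝ≥0, (Ici x).indicator (fun y => waitDensity T H
          (ψ - ((y : ℝ) : AddCircle T)) y * circlePart T ρ (ψ - ((y : ℝ) : AddCircle T))) y
          * g (x, ψ) ∂volumeNN ∂volumeNN := by
        refine lintegral_congr fun x => ?_
        have h1 := lintegral_mul_const (μ := volumeNN) (g (x, ψ))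
          (hm.comp (measurable_prodMk_left (x := x)))
        exact h1.symm
    _ = ∫⁻ y : ℝ≥0, ∫⁻ x, (Ici x).indicator (fun y => waitDensity T H
          (ψ - ((y : ℝ) : AddCircle T)) y * circlePart T ρ (ψ - ((y : ℝ) : AddCircle T))) y
          * g (x, ψ) ∂volumeNN ∂volumeNN :=
        lintegral_lintegral_swap (hm.mul (hgψ.comp measurable_fst)).aemeasurable
    _ = _ := by
        refine lintegral_congr fun y => ?_
        rw [occupation, ← lintegral_indicator measurableSet_Iic,
          ← lintegral_const_mul _ (hgψ.indicator measurableSet_Iic)]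
        refine lintegral_congr fun x => ?_
        by_cases hxy : x ≤ y <;> simp [hxy]

lemma IsRenewalKernel.lintegral_waitDensity_Ici (hH : IsRenewalKernel T lmin lmax H)
    (φ : AddCircle T) (x : ℝ≥0) :
    ∫⁻ y in Ici x, waitDensity T H φ y ∂volumeNN = waitSurvival T H φ x := by
  have hm : Measurable (waitDensity T H φ) := hH.measurable_waitDensity.of_uncurry_left
  rw [← lintegral_indicator measurableSet_Ici, lintegral_volumeNN (hm.indicator measurableSet_Ici),
    waitSurvival, ← hH.lintegral_density_Ioi (by simp), setLIntegral_congr Ioi_ae_eq_Ici,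
    ← lintegral_indicator measurableSet_Ici, ← lintegral_indicator measurableSet_Ici,
    ← lintegral_add_right_eq_self ((Ici ((x : ℝ) + phaseRep φ)).indicator _) (phaseRep φ)]
  refine lintegral_congr fun s => ?_
  by_cases h0 : 0 ≤ s
  · have h2 : x ≤ s.toNNReal ↔ (x : ℝ) + phaseRep φ ≤ s + phaseRep φ := by
      rw [Real.le_toNNReal_iff_coe_le h0, add_le_add_iff_right]
    rw [indicator_of_mem (mem_Ici.mpr h0)]
    by_cases h1 : x ≤ s.toNNReal
    · rw [indicator_of_mem (mem_Ici.mpr h1), indicator_of_mem (mem_Ici.mpr (h2.mp h1)), waitDensity,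
        Real.coe_toNNReal _ h0]
    · rw [indicator_of_notMem (show _ ∉ Ici x from h1),
        indicator_of_notMem (show _ ∉ Ici _ from fun h => h1 (h2.mpr h))]
  · rw [indicator_of_notMem (show _ ∉ Ici (0 : ℝ) from h0), indicator_of_notMem]
    intro h
    have h1 : (x : ℝ) + phaseRep φ ≤ s + phaseRep φ := h
    exact h0 (by linarith [x.coe_nonneg])

/-- By Palm's formula the mass is `1/T` times the `ρ`-integral of the mean waiting time. That mean
is the integral of the survival function, so the normalization equation, integrated over the circle,
gives `T`. -/
lemma IsStationaryIntensity.isProbabilityMeasure_muInfty (hH : IsRenewalKernel T lmin lmax H)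
    (hρ : IsStationaryIntensity T H ρ) : IsProbabilityMeasure (muInfty T H ρ) := by
  have hT0 := hT.out
  have hr := hρ.measurable_circlePart hH
  have h1 : ∀ φ, ∫⁻ z, occupation (fun _ : State T => 1) z ∂(jumpKernel T H φ)
      = ∫⁻ x, waitSurvival T H φ x ∂volumeNN := fun φ => by
    have hm : Measurable (Function.uncurry fun y x : ℝ≥0 =>
        {q : ℝ≥0 × ℝ≥0 | q.2 ≤ q.1}.indicator (fun q => waitDensity T H φ q.1) (y, x)) :=
      (hH.measurable_waitDensity.of_uncurry_left.comp measurable_fst).indicator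
        (measurableSet_le measurable_snd measurable_fst)
    rw [hH.lintegral_jumpKernel φ (measurable_occupation measurable_const)]
    calc ∫⁻ y : ℝ≥0, waitDensity T H φ y
          * occupation (fun _ : State T => 1) (y, φ + ((y : ℝ) : AddCircle T)) ∂volumeNN
        = ∫⁻ y, ∫⁻ x, {q : ℝ≥0 × ℝ≥0 | q.2 ≤ q.1}.indicator (fun q => waitDensity T H φ q.1) (y, x)
            ∂volumeNN ∂volumeNN := by
          refine lintegral_congr fun y => ?_
          rw [occupation, ← lintegral_const_mul _ measurable_const,
            ← lintegral_indicator measurableSet_Iic]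
          refine lintegral_congr fun x => ?_
          by_cases hxy : x ≤ y <;> simp [hxy]
      _ = ∫⁻ x, ∫⁻ y, {q : ℝ≥0 × ℝ≥0 | q.2 ≤ q.1}.indicator (fun q => waitDensity T H φ q.1) (y, x)
            ∂volumeNN ∂volumeNN := lintegral_lintegral_swap hm.aemeasurable
      _ = _ := by
          refine lintegral_congr fun x => ?_
          rw [← hH.lintegral_waitDensity_Ici, ← lintegral_indicator measurableSet_Ici]
          refine lintegral_congr fun y => ?_
          by_cases hxy : x ≤ y <;> simp [hxy]
  refine ⟨?_⟩
  rw [← lintegral_one, hρ.lintegral_muInfty hH measurable_const]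
  simp_rw [h1, mul_comm (circlePart T ρ _)]
  rw [← lintegral_convolve hH.measurable_waitSurvival hr]
  simp_rw [hρ.convolve_waitSurvival hH]
  rw [lintegral_one, AddCircle.measure_univ, ← ENNReal.ofReal_mul (by positivity),
    one_div_mul_cancel hT0.ne', ENNReal.ofReal_one]

end Palm

/-! ### Invariance of `μ̃_∞` by shifting the observation window. -/

section Invariance

variable {T lmin lmax : ℝ} {H : ℝ → ℝ → ℝ} {ρ : ℝ → ℝ} [hT : Fact (0 < T)]

lemma lintegral_semigroup (hH : IsRenewalKernel T lmin lmax H) (t : ℝ≥0) (z : State T)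
    {f : State T → ℝ≥0∞} (hf : Measurable f) :
    ∫⁻ p, f p ∂(semigroup hH t z) = ∫⁻ ω, f (pdmpState t (cons z ω)) ∂(pathKernel hH z.2) := by
  have hm : Measurable fun ω : ℕ → State T => f (pdmpState t ω) := hf.comp (measurable_pdmpState t)
  rw [semigroup, Kernel.lintegral_map _ (measurable_pdmpState t) _ hf, lintegral_chainKernel hH z hm]

/-- The integral of `f` along the path over a time interval of the length of the first waiting
time, from time `t` on. -/
def pathOccupation (f : State T → ℝ≥0∞) (t : ℝ≥0) (ω : ℕ → State T) : ℝ≥0∞ :=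
  ∫⁻ u in Iic (ω 0).1, f (pdmpState (t + u) ω) ∂volumeNN

omit hT in
lemma measurable_comp_uncurry {α β γ δ ε : Type*} [MeasurableSpace α] [MeasurableSpace β]
    [MeasurableSpace γ] [MeasurableSpace δ] [MeasurableSpace ε] {Y : α → β → γ}
    (hY : Measurable (Function.uncurry Y)) {f : γ → ε} (hf : Measurable f) {a : δ → α}
    (ha : Measurable a) {b : δ → β} (hb : Measurable b) : Measurable fun d => f (Y (a d) (b d)) :=
  hf.comp (hY.comp (ha.prodMk hb))

omit hT in
lemma measurable_apply_pdmpState {δ : Type*} [MeasurableSpace δ] {f : State T → ℝ≥0∞}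
    (hf : Measurable f) {a : δ → ℝ≥0} (ha : Measurable a) {b : δ → ℕ → State T}
    (hb : Measurable b) : Measurable fun d => f (pdmpState (a d) (b d)) :=
  measurable_comp_uncurry (Y := pdmpState) measurable_pdmpState_uncurry hf ha hb

omit hT in
lemma measurable_comp_pdmpState_add {f : State T → ℝ≥0∞} (hf : Measurable f) (t : ℝ≥0) :
    Measurable fun p : (ℕ → State T) × ℝ≥0 => f (pdmpState (t + p.2) p.1) :=
  measurable_apply_pdmpState hf (measurable_snd.const_add t) measurable_fst

omit hT in
lemma measurable_comp_pdmpState {f : State T → ℝ≥0∞} (hf : Measurable f) :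
    Measurable fun p : (ℕ → State T) × ℝ≥0 => f (pdmpState p.2 p.1) :=
  measurable_apply_pdmpState hf measurable_snd measurable_fst

omit hT in
lemma measurable_pathOccupation {f : State T → ℝ≥0∞} (hf : Measurable f) (t : ℝ≥0) :
    Measurable (pathOccupation f t) :=
  measurable_setLIntegral_Iic (b := fun ω : ℕ → State T => (ω 0).1)
    (measurable_fst.comp (measurable_pi_apply 0)) (measurable_comp_pdmpState_add hf t)

/-- The state `(u, z.2)` lies on the path from `z` at time `z.1 - u`. Applying `P_t` over the
waiting time thus observes one path at times `t + (z.1 - u)`, and the reflection `u ↦ z.1 - u` gives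
the window from `t` to `t + z.1`. -/
lemma occupation_semigroup (hH : IsRenewalKernel T lmin lmax H) (t : ℝ≥0) (z : State T)
    {f : State T → ℝ≥0∞} (hf : Measurable f) :
    occupation (fun p => ∫⁻ q, f q ∂(semigroup hH t p)) z
      = ∫⁻ ω, pathOccupation f t (cons z ω) ∂(pathKernel hH z.2) := by
  have hr : ∀ ω : ℕ → State T, ∫⁻ u in Iic z.1, f (pdmpState t (cons (u, z.2) ω)) ∂volumeNN
      = pathOccupation f t (cons z ω) := fun ω => by
    have hm : Measurable fun u : ℝ≥0 => f (pdmpState (t + u) (cons z ω)) :=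
      measurable_apply_pdmpState hf (measurable_id.const_add t) measurable_const
    rw [pathOccupation, cons_zero, ← setLIntegral_Iic_reflect hm]
    exact setLIntegral_congr_fun measurableSet_Iic fun u hu => by
      simp only [pdmpState_cons_add (mem_Iic.mp hu), Prod.mk.eta]
  have hm : Measurable (Function.uncurry fun (u : ℝ≥0) (ω : ℕ → State T) =>
      f (pdmpState t (cons (u, z.2) ω))) := by
    have h1 : Measurable fun p : ℝ≥0 × (ℕ → State T) => cons ((p.1, z.2) : State T) p.2 :=
      measurable_cons.comp ((measurable_fst.prodMk measurable_const).prodMk measurable_snd)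
    exact measurable_apply_pdmpState hf measurable_const h1
  simp_rw [occupation, lintegral_semigroup hH t _ hf]
  rw [lintegral_lintegral_swap hm.aemeasurable]
  exact lintegral_congr hr

omit hT in
lemma pathOccupation_zero_cons {f : State T → ℝ≥0∞} (hf : Measurable f) (z : State T)
    (ω : ℕ → State T) : pathOccupation f 0 (cons z ω) = occupation f z := by
  have hm : Measurable fun u : ℝ≥0 => f (u, z.2) := hf.comp measurable_prodMk_right
  -- The endpoint is removed: at time `z.1` the jump has already taken place, because `jumpCount` is
  -- defined with a strict inequality.
  rw [pathOccupation, cons_zero, occupation, ← setLIntegral_Iic_reflect hm,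
    setLIntegral_congr Iio_ae_eq_Iic.symm, setLIntegral_congr (Iio_ae_eq_Iic (a := z.1)).symm]
  refine setLIntegral_congr_fun measurableSet_Iio fun u hu => ?_
  simp only [zero_add, pdmpState_cons_of_lt (mem_Iio.mp hu)]

/-- The mean value of `f` over a waiting time of the stationary process is invariant under time
shifts. -/
lemma IsStationaryIntensity.lintegral_pathOccupation (hH : IsRenewalKernel T lmin lmax H)
    (hρ : IsStationaryIntensity T H ρ) {f : State T → ℝ≥0∞} (hf : Measurable f)
    (hf1 : ∀ p, f p ≤ 1) (t : ℝ≥0) :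
    ∫⁻ φ, circlePart T ρ φ * ∫⁻ ω, pathOccupation f t ω ∂(pathKernel hH φ)
      = ∫⁻ φ, circlePart T ρ φ * ∫⁻ ω, pathOccupation f 0 ω ∂(pathKernel hH φ) := by
  have hr := hρ.measurable_circlePart hH
  have hfp := measurable_comp_pdmpState hf
  have hfω : ∀ ω, Measurable fun u : ℝ≥0 => f (pdmpState u ω) := fun ω =>
    measurable_apply_pdmpState hf measurable_id measurable_const
  let I : (ℕ → State T) → ℝ≥0∞ := fun ω => ∫⁻ u in Iic t, f (pdmpState u ω) ∂volumeNN
  have hI : Measurable I := measurable_setLIntegral_Iic measurable_const hfp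
  let R : (ℕ → State T) → ℝ≥0∞ := fun ω =>
    ∫⁻ u in Iic t, f (pdmpState ((ω 0).1 + u) ω) ∂volumeNN
  have hR : Measurable R := by
    refine measurable_setLIntegral_Iic measurable_const
      (g := fun p : (ℕ → State T) × ℝ≥0 => f (pdmpState ((p.1 0).1 + p.2) p.1)) ?_
    have h : Measurable fun p : (ℕ → State T) × ℝ≥0 => (p.1 0).1 + p.2 :=
      Measurable.add (f := fun p : (ℕ → State T) × ℝ≥0 => (p.1 0).1)
        (measurable_fst.comp ((measurable_pi_apply 0).comp measurable_fst)) measurable_snd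
    exact measurable_apply_pdmpState hf h measurable_fst
  -- Both sides are the integral along the path over `[0, t + x₀]`, cut at `t` and at the first jump
  -- time `x₀`.
  have hsplit : ∀ ω, I ω + pathOccupation f t ω = pathOccupation f 0 ω + R ω := fun ω => by
    have h1 := setLIntegral_Iic_add (hfω ω) t (ω 0).1
    have h2 := setLIntegral_Iic_add (hfω ω) (ω 0).1 t
    rw [add_comm (ω 0).1 t, h1] at h2
    simpa only [pathOccupation, zero_add] using h2
  have hmk : ∀ {F : (ℕ → State T) → ℝ≥0∞}, Measurable F →
      Measurable fun φ => ∫⁻ ω, F ω ∂(pathKernel hH φ) := fun hF => hF.lintegral_kernel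
  have hsum : ∀ {F G : (ℕ → State T) → ℝ≥0∞}, Measurable F → Measurable G →
      ∫⁻ φ, circlePart T ρ φ * ∫⁻ ω, F ω + G ω ∂(pathKernel hH φ)
        = (∫⁻ φ, circlePart T ρ φ * ∫⁻ ω, F ω ∂(pathKernel hH φ))
          + ∫⁻ φ, circlePart T ρ φ * ∫⁻ ω, G ω ∂(pathKernel hH φ) := fun {F G} hF hG => by
    simp_rw [lintegral_add_left hF, mul_add]
    exact lintegral_add_left (hr.mul (hmk hF)) _
  -- `R` is `I` for the path restarted at its first jump (almost surely, by non-explosion), whose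
  -- phase again has density `ρ`.
  have hRI : ∫⁻ φ, circlePart T ρ φ * ∫⁻ ω, R ω ∂(pathKernel hH φ)
      = ∫⁻ φ, circlePart T ρ φ * ∫⁻ ω, I ω ∂(pathKernel hH φ) := by
    rw [← hρ.lintegral_jumpKernel_snd hH (hmk hI)]
    refine lintegral_congr fun φ => ?_
    rw [lintegral_pathKernel hH φ hR]
    congr 1
    refine lintegral_congr fun z => lintegral_congr_ae ?_
    filter_upwards [hH.ae_exists_lt_jumpTime z.2 t] with ω hω
    obtain ⟨n, hn⟩ := hω
    exact setLIntegral_congr_fun measurableSet_Iic fun u hu => by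
      simp only [cons_zero, pdmpState_add_cons z ⟨n, (mem_Iic.mp hu).trans_lt hn⟩]
  -- Needed to cancel this term; `f ≤ 1` gives `I ≤ t`.
  have hfin : ∫⁻ φ, circlePart T ρ φ * ∫⁻ ω, I ω ∂(pathKernel hH φ) ≠ ∞ := by
    have h1 : ∀ ω, I ω ≤ t := fun ω => by
      refine (setLIntegral_mono measurable_const fun u _ => hf1 _).trans ?_
      rw [setLIntegral_Iic_volumeNN measurable_const, lintegral_const, one_mul,
        Measure.restrict_apply_univ, Real.volume_Ioc, sub_zero, ENNReal.ofReal_coe_nnreal]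
    have h2 : ∀ φ, circlePart T ρ φ * ∫⁻ ω, I ω ∂(pathKernel hH φ) ≤ circlePart T ρ φ * t :=
      fun φ => mul_le_mul_right ((lintegral_mono h1).trans (by simp)) _
    refine ne_top_of_le_ne_top ?_ (lintegral_mono h2)
    rw [lintegral_mul_const _ hr]
    exact ENNReal.mul_ne_top (lintegral_circlePart_ne_top hρ.periodic hρ.integrable)
      ENNReal.coe_ne_top
  have h1 := hsum hI (measurable_pathOccupation hf t)
  have h2 := hsum (measurable_pathOccupation hf 0) hR
  simp_rw [hsplit] at h1
  rw [h2, hRI, add_comm] at h1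
  exact ((ENNReal.add_right_inj hfin).mp h1).symm

lemma IsStationaryIntensity.isInvariant_muInfty (hH : IsRenewalKernel T lmin lmax H)
    (hρ : IsStationaryIntensity T H ρ) : IsInvariant hH (muInfty T H ρ) := by
  intro t
  refine Measure.ext fun s hs => ?_
  have hf : Measurable (s.indicator (1 : State T → ℝ≥0∞)) := measurable_one.indicator hs
  have hg : Measurable fun p => ∫⁻ q, s.indicator (1 : State T → ℝ≥0∞) q ∂(semigroup hH t p) :=
    hf.lintegral_kernel
  rw [← lintegral_indicator_one hs, ← lintegral_indicator_one hs,
    Measure.lintegral_bind (semigroup hH t).measurable.aemeasurable hf.aemeasurable,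
    hρ.lintegral_muInfty hH hg, hρ.lintegral_muInfty hH hf]
  congr 1
  have h1 : ∀ φ, ∫⁻ z, occupation (fun p => ∫⁻ q, s.indicator (1 : State T → ℝ≥0∞) q
      ∂(semigroup hH t p)) z ∂(jumpKernel T H φ)
      = ∫⁻ ω, pathOccupation (s.indicator 1) t ω ∂(pathKernel hH φ) := fun φ => by
    rw [lintegral_pathKernel hH φ (measurable_pathOccupation hf t)]
    exact lintegral_congr fun z => occupation_semigroup hH t z hf
  have h2 : ∀ φ, ∫⁻ z, occupation (s.indicator (1 : State T → ℝ≥0∞)) z ∂(jumpKernel T H φ)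
      = ∫⁻ ω, pathOccupation (s.indicator 1) 0 ω ∂(pathKernel hH φ) := fun φ => by
    rw [lintegral_pathKernel hH φ (measurable_pathOccupation hf 0)]
    refine lintegral_congr fun z => ?_
    simp_rw [pathOccupation_zero_cons hf, lintegral_const, measure_univ, mul_one]
  simp_rw [h1, h2]
  exact hρ.lintegral_pathOccupation hH hf
    (fun p => indicator_le_self' (fun _ _ => zero_le) p) t

end Invariance

/-! ### Uniqueness of the invariant law: positivity and Jordan decomposition. -/

section Uniqueness

variable {T lmin lmax : ℝ} {H : ℝ → ℝ → ℝ} [hT : Fact (0 < T)]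

omit hT in
lemma lintegral_add_left_le_volumeNN {h : ℝ≥0 → ℝ≥0∞} (hh : Measurable h) (t : ℝ≥0) :
    ∫⁻ u, h (t + u) ∂volumeNN ≤ ∫⁻ u, h u ∂volumeNN := by
  rw [lintegral_volumeNN_eq_add hh t]
  exact le_add_self

/-- A null set of a nonzero invariant measure is null for the Lebesgue measure on
`[0, T] × ℝ/Tℤ`. -/
lemma IsInvariant.lintegral_eq_zero (hH : IsRenewalKernel T lmin lmax H) {μ : Measure (State T)}
    [SFinite μ] (hμ : IsInvariant hH μ) (hμ0 : μ ≠ 0) {A : Set (State T)} (hA : MeasurableSet A)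
    (hμA : μ A = 0) :
    ∫⁻ ψ, ∫⁻ u in Iic T.toNNReal, A.indicator 1 ((u, ψ) : State T) ∂volumeNN = 0 := by
  have hT0 := hT.out
  set f : State T → ℝ≥0∞ := A.indicator 1 with hf_def
  have hf : Measurable f := measurable_one.indicator hA
  have hfp := measurable_comp_pdmpState hf
  have hocc := measurable_occupation hf
  have h1 : ∀ t, ∫⁻ z, ∫⁻ ω, f (pdmpState t (cons z ω)) ∂(pathKernel hH z.2) ∂μ = 0 := fun t => by
    have h2 : ∫⁻ p, f p ∂(μ.bind (semigroup hH t)) = 0 := by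
      rw [(hμ t).def, hf_def, lintegral_indicator_one hA, hμA]
    rw [Measure.lintegral_bind (semigroup hH t).measurable.aemeasurable hf.aemeasurable] at h2
    simpa only [lintegral_semigroup hH t _ hf] using h2
  have hjoint : Measurable fun q : (State T × ℝ≥0) × (ℕ → State T) =>
      f (pdmpState q.1.2 (cons q.1.1 q.2)) := by
    have hc : Measurable fun q : (State T × ℝ≥0) × (ℕ → State T) => cons q.1.1 q.2 :=
      measurable_cons.comp ((measurable_fst.comp measurable_fst).prodMk measurable_snd)
    exact measurable_apply_pdmpState hf (measurable_snd.comp measurable_fst) hc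
  have hker : Measurable fun q : State T × ℝ≥0 =>
      ∫⁻ ω, f (pdmpState q.2 (cons q.1 ω)) ∂(pathKernel hH q.1.2) :=
    hjoint.lintegral_kernel_prod_right' (κ := (pathKernel hH).comap (fun q : State T × ℝ≥0 => q.1.2)
      (measurable_snd.comp measurable_fst))
  have h2 : ∫⁻ z, ∫⁻ t, ∫⁻ ω, f (pdmpState t (cons z ω)) ∂(pathKernel hH z.2) ∂volumeNN ∂μ = 0 := by
    rw [lintegral_lintegral_swap hker.aemeasurable]
    simp_rw [h1, lintegral_zero]
  -- The total time spent in `A` is at least the time spent there between the first and second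
  -- jumps, whose law has the explicit positive density.
  have h3 : ∀ z : State T, ∫⁻ z', occupation f z' ∂(jumpKernel T H z.2)
      ≤ ∫⁻ t, ∫⁻ ω, f (pdmpState t (cons z ω)) ∂(pathKernel hH z.2) ∂volumeNN := fun z => by
    have hm : Measurable (Function.uncurry fun (t : ℝ≥0) (ω : ℕ → State T) =>
        f (pdmpState t (cons z ω))) :=
      measurable_apply_pdmpState hf measurable_fst ((measurable_cons_left z).comp measurable_snd)
    have h0 : Measurable fun ω : ℕ → State T => occupation f (ω 0) :=
      hocc.comp (measurable_pi_apply 0)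
    have e : ∫⁻ z', occupation f z' ∂(jumpKernel T H z.2)
        = ∫⁻ ω, occupation f (ω 0) ∂(pathKernel hH z.2) := by
      rw [lintegral_pathKernel hH z.2 h0]
      simp_rw [cons_zero, lintegral_const, measure_univ, mul_one]
    rw [e, lintegral_lintegral_swap hm.aemeasurable]
    refine lintegral_mono fun ω => ?_
    have hmω : Measurable fun t : ℝ≥0 => f (pdmpState t (cons z ω)) :=
      measurable_apply_pdmpState hf measurable_id measurable_const
    refine le_trans ?_ (lintegral_add_left_le_volumeNN hmω z.1)
    refine le_trans (le_of_eq ?_) (setLIntegral_le_lintegral (Iio (ω 0).1) _)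
    have hmo : Measurable fun u : ℝ≥0 => f (u, (ω 0).2) := hf.comp measurable_prodMk_right
    rw [occupation, ← setLIntegral_Iic_reflect hmo, setLIntegral_congr Iio_ae_eq_Iic.symm]
    refine setLIntegral_congr_fun measurableSet_Iio fun u hu => ?_
    have hu' : u < (ω 0).1 := hu
    have hj : ∃ n, u < jumpTime ω n := ⟨0, by simpa [jumpTime] using hu'⟩
    simp only [pdmpState_add_cons z hj, pdmpState_of_lt hu']
  have h4 : ∫⁻ z, ∫⁻ z', occupation f z' ∂(jumpKernel T H z.2) ∂μ = 0 :=
    le_antisymm ((lintegral_mono h3).trans h2.le) zero_le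
  have hmj : Measurable fun z : State T => ∫⁻ z', occupation f z' ∂(jumpKernel T H z.2) :=
    hocc.lintegral_kernel.comp measurable_snd
  have : NeZero μ := ⟨hμ0⟩
  obtain ⟨z, hz⟩ := ((lintegral_eq_zero_iff hmj).mp h4).exists
  set φ := z.2
  set τ := T.toNNReal with hτ
  have hτT : (τ : ℝ) = T := Real.coe_toNNReal _ hT0.le
  have hmx : Measurable fun x : ℝ≥0 => waitDensity T H φ x
      * occupation f (x, φ + ((x : ℝ) : AddCircle T)) :=
    hH.measurable_waitDensity.of_uncurry_left.mul (hocc.comp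
      (measurable_id.prodMk (measurable_coe_circle.const_add φ)))
  have h5 : ∫⁻ x, waitDensity T H φ x * occupation f (x, φ + ((x : ℝ) : AddCircle T)) ∂volumeNN
      = 0 := by
    rw [← hH.lintegral_jumpKernel φ hocc]
    exact hz
  -- Only waiting times `T + y` are kept: they all contain the levels `[0, T]`, and the extra period
  -- does not change the phase reached.
  have h6 := le_antisymm ((lintegral_add_left_le_volumeNN hmx τ).trans h5.le) zero_le
  replace h6 := (lintegral_eq_zero_iff (hmx.comp (measurable_const_add τ))).mp h6
  let g : AddCircle T → ℝ≥0∞ := fun ψ => ∫⁻ u in Iic τ, f (u, ψ) ∂volumeNN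
  have hg : Measurable g :=
    measurable_setLIntegral_Iic measurable_const (hf.comp measurable_swap)
  have h7 : ∀ᵐ y ∂volumeNN, g (φ + (((y : ℝ≥0) : ℝ) : AddCircle T)) = 0 := by
    filter_upwards [h6] with y hy
    have h8 := (mul_eq_zero.mp hy).resolve_left (hH.waitDensity_ne_zero _ _)
    have h9 : φ + (((τ + y : ℝ≥0) : ℝ) : AddCircle T) = φ + ((y : ℝ) : AddCircle T) := by
      rw [NNReal.coe_add, hτT, AddCircle.coe_add, AddCircle.coe_period, zero_add]
    rw [h9] at h8
    refine le_antisymm (le_trans ?_ h8.le) zero_le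
    exact lintegral_mono_set (Iic_subset_Iic.mpr le_self_add)
  -- The phases `φ + y`, `y ∈ [0, T)`, also cover the circle; the reflection brings them to the form
  -- `ψ - x`.
  have h8 := lintegral_sub_coe_Ico (hg.comp measurable_neg) (-φ)
  have h9 : ∫⁻ ψ, (g ∘ Neg.neg) ψ = ∫⁻ ψ, g ψ := lintegral_neg_eq_self g
  refine (h9.symm.trans h8.symm).trans ?_
  refine (lintegral_congr_ae (h7.mono fun y hy => ?_)).trans lintegral_zero
  have e : -(-φ - ((y : ℝ) : AddCircle T)) = φ + ((y : ℝ) : AddCircle T) := by abel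
  simp only [Function.comp, e, hy, mul_zero]

/-- Nonzero invariant measures are never mutually singular. -/
lemma IsInvariant.not_mutuallySingular (hH : IsRenewalKernel T lmin lmax H)
    {μ ν : Measure (State T)} [SFinite μ] [SFinite ν] (hμ : IsInvariant hH μ)
    (hν : IsInvariant hH ν) (hμ0 : μ ≠ 0) (hν0 : ν ≠ 0) : ¬ μ ⟂ₘ ν := by
  rintro ⟨A, hA, hμA, hνA⟩
  have h1 := hμ.lintegral_eq_zero hH hμ0 hA hμA
  have h2 := hν.lintegral_eq_zero hH hν0 hA.compl hνA
  have hm : ∀ {B : Set (State T)}, MeasurableSet B → Measurable fun p : AddCircle T × ℝ≥0 =>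
      B.indicator (1 : State T → ℝ≥0∞) (p.2, p.1) := fun hB =>
    (measurable_one.indicator hB).comp measurable_swap
  have h3 : ∫⁻ ψ : AddCircle T, ∫⁻ u in Iic T.toNNReal,
      (A.indicator (1 : State T → ℝ≥0∞) (u, ψ) + Aᶜ.indicator (1 : State T → ℝ≥0∞) (u, ψ))
        ∂volumeNN = 0 := by
    have h4 : ∀ ψ : AddCircle T, Measurable fun u : ℝ≥0 =>
        A.indicator (1 : State T → ℝ≥0∞) (u, ψ) := fun ψ => (hm hA).comp measurable_prodMk_left
    simp_rw [lintegral_add_left (h4 _)]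
    rw [lintegral_add_left (measurable_setLIntegral_Iic measurable_const (hm hA)), h1, h2, add_zero]
  have h4 : ∀ p, A.indicator (1 : State T → ℝ≥0∞) p + Aᶜ.indicator (1 : State T → ℝ≥0∞) p = 1 :=
    fun p => by rw [← Pi.add_apply, indicator_self_add_compl, Pi.one_apply]
  simp_rw [h4] at h3
  rw [setLIntegral_Iic_volumeNN measurable_const, Real.coe_toNNReal _ hT.out.le] at h3
  have := hT.out
  simp [this.not_ge] at h3

omit hT in
-- As signed measures, the difference of `μ` and `ν` is `μ - ν` minus `ν - μ` (truncated
-- differences); the second, nonnegative, part is dropped.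
lemma le_sub_add_measure {α : Type*} [MeasurableSpace α] {μ ν : Measure α} [IsFiniteMeasure μ]
    [IsFiniteMeasure ν] : μ ≤ (μ - ν) + ν := by
  refine Measure.le_iff.mpr fun s hs => ?_
  have h := congrArg (fun κ : SignedMeasure α => κ s)
    (Measure.sub_toSignedMeasure_eq_toSignedMeasure_sub (μ := μ) (ν := ν))
  simp only [_root_.sub_apply, Measure.toSignedMeasure_apply_measurable hs] at h
  rw [Measure.add_apply, ← ENNReal.toReal_le_toReal (measure_ne_top _ _) (by finiteness),
    ENNReal.toReal_add (measure_ne_top _ _) (measure_ne_top _ _)]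
  simp only [Measure.real] at h
  have : 0 ≤ ((ν - μ) s).toReal := ENNReal.toReal_nonneg
  linarith

/-- The positive part of a difference of invariant measures is invariant. -/
lemma IsInvariant.sub (hH : IsRenewalKernel T lmin lmax H) {μ ν : Measure (State T)}
    [IsFiniteMeasure μ] [IsFiniteMeasure ν] (hμ : IsInvariant hH μ) (hν : IsInvariant hH ν) :
    IsInvariant hH (μ - ν) := by
  intro t
  have hk : ∀ κ : Measure (State T), AEMeasurable (semigroup hH t) κ := fun κ =>
    (semigroup hH t).measurable.aemeasurable
  have h0 : μ ≤ (μ - ν) + ν := le_sub_add_measure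
  -- `P_t` is applied to `μ ≤ (μ - ν) + ν`, with `μ` and `ν` invariant. Minimality of `μ - ν` then
  -- gives `μ - ν ≤ (μ - ν) P_t`, and a Markov kernel preserves total mass.
  have h1 : μ ≤ (μ - ν).bind (semigroup hH t) + ν := by
    refine Measure.le_iff.mpr fun s hs => ?_
    rw [Measure.add_apply]
    conv_lhs => rw [← (hμ t).def]
    conv_rhs => enter [2]; rw [← (hν t).def]
    rw [Measure.bind_apply hs (hk _), Measure.bind_apply hs (hk _), Measure.bind_apply hs (hk _),
      ← lintegral_add_measure]
    exact lintegral_mono' h0 le_rfl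
  have h2 : (μ - ν) ≤ (μ - ν).bind (semigroup hH t) := Measure.sub_le_of_le_add h1
  refine (Measure.eq_of_le_of_measure_univ_eq h2 ?_).symm
  rw [Measure.bind_apply MeasurableSet.univ (hk _)]
  simp

lemma IsInvariant.unique (hH : IsRenewalKernel T lmin lmax H) {μ ν : Measure (State T)}
    [IsProbabilityMeasure μ] [IsProbabilityMeasure ν] (hμ : IsInvariant hH μ)
    (hν : IsInvariant hH ν) : μ = ν := by
  have h0 : ∀ {μ ν : Measure (State T)}, IsProbabilityMeasure μ → IsProbabilityMeasure ν →
      μ - ν = 0 → μ = ν := fun {μ ν} _ _ h => by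
    have h1 : μ ≤ (μ - ν) + ν := le_sub_add_measure
    rw [h, zero_add] at h1
    exact Measure.eq_of_le_of_measure_univ_eq h1 (by simp)
  by_contra hne
  refine (hμ.sub hH hν).not_mutuallySingular hH (hν.sub hH hμ) (fun h => hne (h0 ‹_› ‹_› h))
    (fun h => hne (h0 ‹_› ‹_› h).symm) Measure.mutually_singular_measure_sub

end Uniqueness

end PeriodicRenewal

end

theorem mainTheorem7 (T : ℝ) [Fact (0 < T)] (lmin lmax : ℝ) (H : ℝ → ℝ → ℝ)
    (hH : PeriodicRenewal.IsRenewalKernel T lmin lmax H) :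
    (∃! ρ : ℝ → ℝ, PeriodicRenewal.IsStationaryIntensity T H ρ) ∧
    ∀ ρ : ℝ → ℝ, PeriodicRenewal.IsStationaryIntensity T H ρ →
      IsProbabilityMeasure (PeriodicRenewal.muInfty T H ρ) ∧
      PeriodicRenewal.IsInvariant hH (PeriodicRenewal.muInfty T H ρ) ∧
      ∀ μ : Measure (PeriodicRenewal.State T), IsProbabilityMeasure μ →
        PeriodicRenewal.IsInvariant hH μ → μ = PeriodicRenewal.muInfty T H ρ := by
  obtain ⟨ρ₀, hρ₀⟩ := hH.exists_stationaryIntensity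
  refine ⟨⟨ρ₀, hρ₀, fun ρ hρ => hρ.unique hH hρ₀⟩, fun ρ hρ => ?_⟩
  have hp := hρ.isProbabilityMeasure_muInfty hH
  exact ⟨hp, hρ.isInvariant_muInfty hH, fun μ _ hμ => hμ.unique hH (hρ.isInvariant_muInfty hH)⟩
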